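/- Let $G=(V,E)$ be a directed acyclic graph with $n\ge 1$ vertices, $m$ edges and real edge weights $w(u,v)$, let $v_s\in V$, and suppose that the out-degrees and in-degrees are known, while the lists of out-neighbours and of in-neighbours of the vertices (in arbitrary order) can be accessed only through a quantum oracle $|i\rangle|z\rangle|a\rangle\mapsto|i\rangle|z+x_i\rangle|a\rangle$, where $x_i$ consists of the other endpoint and the weight of the edge at list entry $i$. The running time of an algorithm is its number of oracle queries (quantum or classical). The single-source longest path problem asks for $t[v]$, $v\in V$, where $t[v]$ is the maximal total weight of a path from $v_s$ to $v$, and $t[v]=-\infty$ if $v$ is not reachable from $v_s$. Consider the following algorithm. 1. Topological sort. Run a depth-first search from every unvisited source (vertex of in-degree $0$). The search at a vertex $v$ marks $v$ as visited; if $v$ is not a sink (vertex of out-degree $0$), it repeatedly finds the first entry after the current position in the list of out-neighbours of $v$ that is an unvisited non-sink, and recurses on it, until no such entry is found; then it puts $v$ in front of the order. The sinks are placed at the end of the order. Each search for the first entry consists of $\lceil 2\log_2 n\rceil$ repetitions of the following, of which the smallest position found is taken: for block lengths $1,2,4,\dots$, apply the Dürr–Høyer algorithm to find the first unvisited non-sink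 in the block of that length that starts after the current position, and stop as soon as one is found or the end of the list has been covered. 2. Put $t[s]=0$ and $t[v]=-\infty$ for $v\ne v_s$. For the vertices $v$ that follow $v_s$ in the order, one after the other, set $t[v]$ to the largest of the results of $\lceil 2\log_2 n\rceil$ runs of the Dürr–Høyer algorithm for the maximum of $t[u]+w(u,v)$ over the in-neighbours $u$ of $v$ (to $-\infty$ if there are none). Return $t$. Here the Dürr–Høyer algorithm on $N$ items starts from a uniformly random item as threshold, repeatedly replaces the threshold by a better item found by exponential Grover search (the search draws the number of Grover iterations uniformly from the nonnegative integers below $\min(\lambda^r,\sqrt N)$ in round $r=0,1,2,\dots$, with $\lambda=6/5$), is interrupted after $\lceil 256\sqrt N\rceil$ queries, and returns the threshold. There is an absolute constant $C$ such that for all $G$, $w$, $v_s$ and all orders of the lists, the expected running time of this algorithm is at most $C\sqrt{nm}\,\log n$, and the probability that its output is not the solution of the single-source longest path problem is at most $C/n$. -/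

import Mathlib

open scoped ENNReal

noncomputable section

/-! ## The quantum query model -/

/-- The state space `ℓ²(B)` with computational basis `B`. -/
abbrev QState (B : Type) : Type := lp (fun _ : B => ℂ) 2

theorem memlp_perm {B : Type} (σ : Equiv.Perm B) (ψ : QState B) :
    Memℓp (fun b => ψ (σ.symm b)) 2 := by
  apply memℓp_gen
  have h := (lp.memℓp ψ).summable (by norm_num : 0 < (2 : ℝ≥0∞).toReal)
  exact (σ.symm.summable_iff).2 h

/-- The unitary that permutes the basis states: `|b⟩ ↦ |σ b⟩`. -/
def permUnitary {B : Type} (σ : Equiv.Perm B) : QState B ≃ₗᵢ[ℂ] QState B where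
  toFun ψ := ⟨fun b => ψ (σ.symm b), memlp_perm σ ψ⟩
  invFun ψ := ⟨fun b => ψ (σ b), memlp_perm σ.symm ψ⟩
  map_add' ψ φ := by ext b; rfl
  map_smul' c ψ := by ext b; simp
  left_inv ψ := by ext b; simp
  right_inv ψ := by ext b; simp
  norm_map' ψ := by
    have h2 : 0 < (2 : ℝ≥0∞).toReal := by norm_num
    simp only [lp.norm_eq_tsum_rpow h2]
    congr 1
    exact σ.symm.tsum_eq (fun b => ‖ψ b‖ ^ (2 : ℝ≥0∞).toReal)

open Classical in
theorem memlp_sign {B : Type} (S : Set B) (ψ : QState B) :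
    Memℓp (fun b => if b ∈ S then -ψ b else ψ b) 2 := by
  apply memℓp_gen
  have h := (lp.memℓp ψ).summable (by norm_num : 0 < (2 : ℝ≥0∞).toReal)
  refine h.congr fun b => ?_
  split_ifs <;> simp

open Classical in
/-- The diagonal unitary that flips the sign of the basis states in `S`. -/
def signUnitary {B : Type} (S : Set B) : QState B ≃ₗᵢ[ℂ] QState B where
  toFun ψ := ⟨fun b => if b ∈ S then -ψ b else ψ b, memlp_sign S ψ⟩
  invFun ψ := ⟨fun b => if b ∈ S then -ψ b else ψ b, memlp_sign S ψ⟩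
  map_add' ψ φ := by
    ext b
    simp only [lp.coeFn_add, Pi.add_apply]
    by_cases h : b ∈ S <;> simp [h, add_comm]
  map_smul' c ψ := by
    ext b
    by_cases h : b ∈ S <;> simp [h]
  left_inv ψ := by
    ext b
    by_cases h : b ∈ S <;> simp [h]
  right_inv ψ := by
    ext b
    by_cases h : b ∈ S <;> simp [h]
  norm_map' ψ := by
    have h2 : 0 < (2 : ℝ≥0∞).toReal := by norm_num
    simp only [lp.norm_eq_tsum_rpow h2]
    congr 1
    refine tsum_congr fun b => ?_
    by_cases h : b ∈ S <;> simp [h]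

/-- The input oracle `|i⟩|z⟩|w⟩ ↦ |i⟩|z + x i⟩|w⟩`. -/
def oracleUnitary {I A W : Type} [AddGroup A] (x : I → A) :
    QState (I × A × W) ≃ₗᵢ[ℂ] QState (I × A × W) :=
  permUnitary
    { toFun := fun b => (b.1, b.2.1 + x b.1, b.2.2)
      invFun := fun b => (b.1, b.2.1 - x b.1, b.2.2)
      left_inv := fun b => by simp
      right_inv := fun b => by simp }

/-- A quantum query circuit: an index register `I`, an answer register `A`, a workspace `W`, a fixed
initial state and input-independent unitaries `U₁, …, U_T`. On the input `x` it prepares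
`U_T O_x ⋯ U₂ O_x U₁ O_x |init⟩` with `T` oracle calls. -/
structure QCircuit (I A : Type) where
  /-- the workspace -/
  W : Type
  /-- the initial state -/
  init : QState (I × A × W)
  norm_init : ‖init‖ = 1
  /-- the unitaries, in the order in which they are applied -/
  unitaries : List (QState (I × A × W) ≃ₗᵢ[ℂ] QState (I × A × W))

namespace QCircuit

variable {I A : Type}

/-- The number of oracle calls of a circuit. -/
def queries (c : QCircuit I A) : ℕ := c.unitaries.length

/-- The state before the measurement. -/
def finalState [AddGroup A] (x : I → A) (c : QCircuit I A) : QState (I × A × c.W) :=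
  c.unitaries.foldl (fun ψ U => U (oracleUnitary x ψ)) c.init

theorem norm_finalState [AddGroup A] (x : I → A) (c : QCircuit I A) : ‖c.finalState x‖ = 1 := by
  have key : ∀ (l : List (QState (I × A × c.W) ≃ₗᵢ[ℂ] QState (I × A × c.W)))
      (ψ : QState (I × A × c.W)),
      ‖l.foldl (fun ψ U => U (oracleUnitary x ψ)) ψ‖ = ‖ψ‖ := by
    intro l
    induction l with
    | nil => intro ψ; rfl
    | cons U l ih => intro ψ; simp [ih]
  rw [finalState, key, c.norm_init]

/-- The distribution of the outcome when all registers are measured in the computational basis. -/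
def measure [AddGroup A] (x : I → A) (c : QCircuit I A) : PMF (I × A × c.W) :=
  ⟨fun b => ENNReal.ofReal (‖c.finalState x b‖ ^ 2), by
    have h2 : 0 < (2 : ℝ≥0∞).toReal := by norm_num
    have h := lp.hasSum_norm h2 (c.finalState x)
    rw [norm_finalState] at h
    norm_num at h
    have h' := (ENNReal.hasSum_coe (f := fun b => (‖c.finalState x b‖ ^ 2).toNNReal)
      (r := (1 : ℝ).toNNReal)).2 (by
        rw [← NNReal.hasSum_coe]
        simpa using h)
    simpa [ENNReal.ofReal] using h'⟩

end QCircuit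

/-- Classical algorithms with quantum query subroutines: a program may return a value, draw an element
of a finite set uniformly at random, make one classical query, or run a quantum query circuit,
measure it, and continue according to the outcome. -/
inductive QProg (I A α : Type) : Type 1
  | ret (a : α) : QProg I A α
  | rand {β : Type} (S : Finset β) (hS : S.Nonempty) (k : β → QProg I A α) : QProg I A α
  | query (i : I) (k : A → QProg I A α) : QProg I A α
  | exec (c : QCircuit I A) (k : I × A × c.W → QProg I A α) : QProg I A α

namespace QProg

variable {I A α β : Type}

/-- Sequential composition of programs. -/
def bind : QProg I A α → (α → QProg I A β) → QProg I A β
  | ret a, f => f a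
  | rand S hS k, f => rand S hS fun b => (k b).bind f
  | query i k, f => query i fun a => (k a).bind f
  | exec c k, f => exec c fun b => (k b).bind f

instance : Monad (QProg I A) where
  pure := ret
  bind := bind

/-- Draw an element of a nonempty finite set uniformly at random. -/
def draw (S : Finset α) (hS : S.Nonempty) : QProg I A α := rand S hS ret

/-- A classical query. -/
def ask (i : I) : QProg I A A := query i ret

/-- Run and measure a circuit; the outcome of the index register is returned. -/
def measureIndex (c : QCircuit I A) : QProg I A I := exec c fun b => ret b.1

/-- The joint distribution of the returned value and of the number of queries made by a program
on the input `x`. -/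
def run [AddGroup A] (x : I → A) : QProg I A α → PMF (α × ℕ)
  | ret a => PMF.pure (a, 0)
  | rand S hS k => (PMF.uniformOfFinset S hS).bind fun b => (k b).run x
  | query i k => ((k (x i)).run x).map fun r => (r.1, r.2 + 1)
  | exec c k => (c.measure x).bind fun b => ((k b).run x).map fun r => (r.1, r.2 + c.queries)

/-- The expected number of queries of a program on the input `x`. -/
def expectedQueries [AddGroup A] (x : I → A) (P : QProg I A α) : ℝ≥0∞ :=
  ∑' r : α × ℕ, P.run x r * (r.2 : ℝ≥0∞)

/-- The probability that the value returned on the input `x` is not in `S`. -/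
def errorProb [AddGroup A] (x : I → A) (P : QProg I A α) (S : Set α) : ℝ≥0∞ :=
  (P.run x).toOuterMeasure {r | r.1 ∉ S}

/-- Run a program `k` times and combine the results by `op`, starting from `e`. -/
def boost (op : α → α → α) (e : α) (P : QProg I A α) : ℕ → QProg I A α
  | 0 => ret e
  | k + 1 => do
    let a ← P
    let b ← boost op e P k
    pure (op a b)

end QProg

/-! ## Grover's search and the Dürr–Høyer maximum -/

section Search

variable {I A : Type} [AddGroup A]

open Classical in
/-- The basis states `|i⟩|0⟩` with `i ∈ P`. -/
def searchBasis (A : Type) [AddGroup A] (P : Finset I) : Finset (I × A × Unit) :=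
  P.image fun i => (i, 0, ())

open Classical in
/-- The uniform superposition of the basis states `|i⟩|0⟩` with `i ∈ P`. -/
def uniformState (A : Type) [AddGroup A] (P : Finset I) : QState (I × A × Unit) :=
  ∑ b ∈ searchBasis A P, lp.single 2 b (((√(P.card : ℝ))⁻¹ : ℝ) : ℂ)

open Classical in
theorem norm_uniformState (P : Finset I) (hP : P.Nonempty) : ‖uniformState A P‖ = 1 := by
  have h2 : 0 < (2 : ℝ≥0∞).toReal := by norm_num
  have h := lp.norm_sum_single (E := fun _ : I × A × Unit => ℂ) h2
    (fun _ => (((√(P.card : ℝ))⁻¹ : ℝ) : ℂ)) (searchBasis A P)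
  have hc : (searchBasis A P).card = P.card :=
    Finset.card_image_of_injective _ fun i j hij => congrArg Prod.fst hij
  have hpos : (0 : ℝ) < P.card := by exact_mod_cast hP.card_pos
  have h' : ‖uniformState A P‖ ^ 2 = 1 := by
    have : ‖uniformState A P‖ ^ (2 : ℝ≥0∞).toReal = 1 := by
      rw [uniformState, h, Finset.sum_const, hc, Complex.norm_real]
      norm_num
      exact mul_inv_cancel₀ hpos.ne'
    simpa using this
  nlinarith [norm_nonneg (uniformState A P)]

/-- One Grover iteration takes two oracle calls. After the first call the phase of the marked answers
is flipped and the answer register is negated, `z ↦ -z`, so that the second call resets it to zero;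
the second unitary is the inversion about the mean, `2|u⟩⟨u| - 1`, for the uniform superposition
`u` over `P`. -/
def groverIteration (P : Finset I) (mark : I → A → Prop) :
    List (QState (I × A × Unit) ≃ₗᵢ[ℂ] QState (I × A × Unit)) :=
  [(signUnitary {b | mark b.1 b.2.1}).trans
      (permUnitary ((Equiv.refl I).prodCongr ((Equiv.neg A).prodCongr (Equiv.refl Unit)))),
    (ℂ ∙ uniformState A P).reflection]

/-- `j` Grover iterations on the positions `P`, started in the uniform superposition. -/
def groverCircuit (P : Finset I) (hP : P.Nonempty) (mark : I → A → Prop) (j : ℕ) :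
    QCircuit I A where
  W := Unit
  init := uniformState A P
  norm_init := norm_uniformState P hP
  unitaries := (List.replicate j (groverIteration P mark)).flatten

/-- The bound `min (λ ^ r) √N`, `λ = 6/5`, on the number of Grover iterations in round `r` of the
exponential search. -/
def searchBound (N r : ℕ) : ℝ := min ((6 / 5 : ℝ) ^ r) √(N : ℝ)

theorem searchBound_range_nonempty {N : ℕ} (hN : 0 < N) (r : ℕ) :
    (Finset.range ⌈searchBound N r⌉₊).Nonempty := by
  rw [Finset.nonempty_range_iff]
  have hN' : (0 : ℝ) < N := by exact_mod_cast hN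
  exact (Nat.ceil_pos.2 (lt_min (by positivity) (Real.sqrt_pos.2 hN'))).ne'

variable {κ : Type} [LinearOrder κ]

/-- The main loop of the Dürr–Høyer maximum with `b` queries left: `y` is the current threshold (a
position together with its answer) and `r` the current round of the exponential search for a
position with a larger key. A round draws `j` uniformly among the nonnegative integers below
`searchBound`, makes `j` Grover iterations, and queries the measured position; a position with a
larger key becomes the threshold and the exponential search starts anew. The loop is interrupted
as soon as the budget does not suffice. -/
def durrHoyerLoop (P : Finset I) (hP : P.Nonempty) (key : I → A → κ) (b r : ℕ) (y : I × A) :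
    QProg I A (I × A) := do
  let j ← QProg.draw (Finset.range ⌈searchBound P.card r⌉₊)
    (searchBound_range_nonempty hP.card_pos r)
  if _h : 2 * j + 1 ≤ b then
    let i ← QProg.measureIndex (groverCircuit P hP (fun i a => key y.1 y.2 < key i a) j)
    let a ← QProg.ask i
    if key y.1 y.2 < key i a then
      durrHoyerLoop P hP key (b - (2 * j + 1)) 0 (i, a)
    else
      durrHoyerLoop P hP key (b - (2 * j + 1)) (r + 1) y
  else
    pure y
termination_by b

/-- The Dürr–Høyer search for a position in `P` with the largest key: the threshold is first drawn
uniformly at random, and the main loop is interrupted after `⌈256 √|P|⌉` queries. The position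
found is returned with its answer. -/
def durrHoyerMax (P : Finset I) (hP : P.Nonempty) (key : I → A → κ) : QProg I A (I × A) := do
  let i ← QProg.draw P hP
  let a ← QProg.ask i
  durrHoyerLoop P hP key ⌈256 * √(P.card : ℝ)⌉₊ 0 (i, a)

end Search

/-! ## Weighted directed acyclic graphs and longest paths -/

/-- A weighted directed acyclic graph with `n` vertices. -/
structure WeightedDAG (n : ℕ) where
  /-- `Adj u v` says that there is an edge from `u` to `v`. -/
  Adj : Fin n → Fin n → Prop
  acyclic : ∀ v, ¬ Relation.TransGen Adj v v
  /-- the weight of the edge from `u` to `v` -/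
  weight : Fin n → Fin n → ℝ

namespace WeightedDAG

variable {n : ℕ}

/-- The number of edges. -/
def numEdges (G : WeightedDAG n) : ℕ := {e : Fin n × Fin n | G.Adj e.1 e.2}.ncard

/-- `G.PathOfLength u v ℓ`: there is a path from `u` to `v` whose edge weights sum to `ℓ`. -/
inductive PathOfLength (G : WeightedDAG n) (u : Fin n) : Fin n → ℝ → Prop
  | nil : PathOfLength G u u 0
  | snoc {v w : Fin n} {ℓ : ℝ} (p : PathOfLength G u v ℓ) (e : G.Adj v w) :
      PathOfLength G u w (ℓ + G.weight v w)

/-- The solutions of the single source longest path problem: `t v` is the length of the longest path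
from `s` to `v`, or `⊥`, standing for `-∞`, if `v` is not reachable from `s`. -/
def longestPathSolutions (G : WeightedDAG n) (s : Fin n) : Set (Fin n → WithBot ℝ) :=
  {t | ∀ v, (t v = ⊥ ∧ ∀ ℓ, ¬ G.PathOfLength s v ℓ) ∨
    ∃ ℓ : ℝ, t v = (ℓ : WithBot ℝ) ∧ IsGreatest {ℓ' | G.PathOfLength s v ℓ'} ℓ}

/-- A representation of `G` by adjacency lists: the out-neighbours and the in-neighbours of every
vertex, each list in an arbitrary order. -/
structure AdjLists (G : WeightedDAG n) where
  outList : Fin n → List (Fin n)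
  inList : Fin n → List (Fin n)
  nodup_outList : ∀ v, (outList v).Nodup
  nodup_inList : ∀ v, (inList v).Nodup
  mem_outList : ∀ u v, v ∈ outList u ↔ G.Adj u v
  mem_inList : ∀ u v, u ∈ inList v ↔ G.Adj u v

end WeightedDAG

/-- The positions that can be queried: the entry `p` of the list of out-neighbours, or of the list of
in-neighbours, of the vertex `v`. -/
inductive Slot (n : ℕ) : Type
  | outSlot (v : Fin n) (p : ℕ) : Slot n
  | inSlot (v : Fin n) (p : ℕ) : Slot n

/-- The position in the list. -/
def Slot.pos {n : ℕ} : Slot n → ℕ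
  | outSlot _ p => p
  | inSlot _ p => p

/-- The answer to a query: the other endpoint and the weight of the edge in question. -/
abbrev EdgeInfo (n : ℕ) : Type := Fin n × ℝ

/-- The out-degrees and in-degrees of the vertices. -/
structure Degrees (n : ℕ) where
  outDeg : Fin n → ℕ
  inDeg : Fin n → ℕ

namespace WeightedDAG.AdjLists

variable {n : ℕ} {G : WeightedDAG n}

/-- The lengths of the adjacency lists. -/
def degrees (D : G.AdjLists) : Degrees n where
  outDeg v := (D.outList v).length
  inDeg v := (D.inList v).length

/-- The input oracle; entries beyond the end of a list are zero. -/
def oracle [NeZero n] (D : G.AdjLists) : Slot n → EdgeInfo n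
  | .outSlot v p => match (D.outList v)[p]? with
    | some u => (u, G.weight v u)
    | none => 0
  | .inSlot v p => match (D.inList v)[p]? with
    | some u => (u, G.weight u v)
    | none => 0

end WeightedDAG.AdjLists

/-! ## The algorithm. The degrees are known to it; the lists are accessed through queries only. -/

section Algorithm

variable {n : ℕ} [NeZero n]

/-- Programs that query the adjacency lists. -/
abbrev GraphProg (n : ℕ) (α : Type) : Type 1 := QProg (Slot n) (EdgeInfo n) α

/-- The number of repetitions `⌈2 log₂ n⌉`. -/
def numReps (n : ℕ) : ℕ := Nat.clog 2 (n ^ 2)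

/-- The answers that lead to an unvisited vertex which is not a sink. -/
def IsFresh (deg : Degrees n) (visited : Finset (Fin n)) (a : EdgeInfo n) : Prop :=
  a.1 ∉ visited ∧ 0 < deg.outDeg a.1

open Classical in
/-- The entries `start, …, start + len - 1` of the list of out-neighbours of `v`, as far as they
exist. -/
def outBlock (deg : Degrees n) (v : Fin n) (start len : ℕ) : Finset (Slot n) :=
  (Finset.Ico start (min (start + len) (deg.outDeg v))).image (Slot.outSlot v)

open Classical in
/-- Search for the first fresh entry among the entries `start, start + 1, …` of the list of
out-neighbours of `v`: for each `e` in the given list, a Dürr–Høyer search looks for the first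
fresh entry among the next `2 ^ e` entries, until one is found. -/
def firstOneStages (deg : Degrees n) (visited : Finset (Fin n)) (v : Fin n) (start : ℕ) :
    List ℕ → GraphProg n (Option ℕ)
  | [] => pure none
  | e :: es =>
    if h : (outBlock deg v start (2 ^ e)).Nonempty then do
      let y ← durrHoyerMax (outBlock deg v start (2 ^ e)) h
        (fun i a => OrderDual.toDual
          (if IsFresh deg visited a then (i.pos : WithTop ℕ) else ⊤))
      if IsFresh deg visited y.2 then pure (some y.1.pos)
      else firstOneStages deg visited v start es
    else pure none

/-- The first-one search among the entries `start, start + 1, …` of the list of out-neighbours of `v`,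
with blocks of doubling lengths `1, 2, 4, …`, repeated `⌈2 log₂ n⌉` times; the smallest of the
positions found is returned. -/
def firstOneSearch (deg : Degrees n) (visited : Finset (Fin n)) (v : Fin n) (start : ℕ) :
    GraphProg n (Option ℕ) :=
  QProg.boost (Option.merge min) none
    (firstOneStages deg visited v start
      (List.range (Nat.clog 2 (deg.outDeg v - start) + 1)))
    (numReps n)

/-- The data of the topological sort: the visited vertices, and the list of result order. -/
structure SortState (n : ℕ) where
  visited : Finset (Fin n)
  order : List (Fin n)

/-- The while loop of the depth-first search at `v`; `g` bounds the number of its steps and `dfs` is the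
recursive call. -/
def topSortScan (deg : Degrees n) (dfs : Fin n → SortState n → GraphProg n (SortState n))
    (v : Fin n) : ℕ → ℕ → SortState n → GraphProg n (SortState n)
  | 0, _, st => pure st
  | g + 1, start, st => do
    match ← firstOneSearch deg st.visited v start with
    | none => pure st
    | some z =>
      let a ← QProg.ask (Slot.outSlot v z)
      let st' ← dfs a.1 st
      topSortScan deg dfs v g (z + 1) st'

/-- The depth-first search at `v`; the first argument bounds the depth of the recursion. When it is
finished with a vertex that is not a sink, it adds the vertex to the top of the order. -/
def topSortDFS (deg : Degrees n) : ℕ → Fin n → SortState n → GraphProg n (SortState n)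
  | 0, _, st => pure st
  | f + 1, v, st =>
    if 0 < deg.outDeg v then do
      let st' ← topSortScan deg (topSortDFS deg f) v (deg.outDeg v + 1) 0
        ⟨insert v st.visited, st.order⟩
      pure ⟨st'.visited, v :: st'.order⟩
    else pure ⟨insert v st.visited, st.order⟩

/-- The depth-first searches from the unvisited vertices of a list. -/
def topSortFrom (deg : Degrees n) : List (Fin n) → SortState n → GraphProg n (SortState n)
  | [], st => pure st
  | v :: l, st =>
    if v ∈ st.visited then topSortFrom deg l st
    else do
      let st' ← topSortDFS deg n v st
      topSortFrom deg l st'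

/-- The topological sort: the vertices that are not sinks are ordered by depth-first searches from the
sources, and the sinks come last. -/
def topSort (deg : Degrees n) : GraphProg n (List (Fin n)) := do
  let st ← topSortFrom deg ((List.finRange n).filter fun v => deg.inDeg v = 0) ⟨∅, []⟩
  pure (st.order ++ (List.finRange n).filter fun v => deg.outDeg v = 0)

open Classical in
/-- The entries of the list of in-neighbours of `v`. -/
def inBlock (deg : Degrees n) (v : Fin n) : Finset (Slot n) :=
  (Finset.range (deg.inDeg v)).image (Slot.inSlot v)

/-- The Dürr–Høyer maximum of `t u + weight u v` over the in-neighbours `u` of `v`; the maximum of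
the empty family is `⊥`. -/
def maxOverIn (deg : Degrees n) (t : Fin n → WithBot ℝ) (v : Fin n) :
    GraphProg n (WithBot ℝ) :=
  if h : (inBlock deg v).Nonempty then do
    let y ← durrHoyerMax (inBlock deg v) h (fun _ a => t a.1 + (a.2 : WithBot ℝ))
    pure (t y.2.1 + (y.2.2 : WithBot ℝ))
  else pure ⊥

/-- The main loop: at each vertex, the Dürr–Høyer maximum is repeated `⌈2 log₂ n⌉` times, and the
largest result is stored. -/
def relaxLoop (deg : Degrees n) : List (Fin n) → (Fin n → WithBot ℝ) →
    GraphProg n (Fin n → WithBot ℝ)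
  | [], t => pure t
  | v :: l, t => do
    let x ← QProg.boost max ⊥ (maxOverIn deg t v) (numReps n)
    relaxLoop deg l (Function.update t v x)

/-- The quantum algorithm for longest paths from `s`: after the topological sort, the vertices that
follow `s` are processed in topological order. -/
def longestPathAlgorithm (deg : Degrees n) (s : Fin n) : GraphProg n (Fin n → WithBot ℝ) := do
  let order ← topSort deg
  relaxLoop deg (order.dropWhile (fun v => v ≠ s)).tail
    (Function.update (fun _ => ⊥) s 0)

end Algorithm

end

/-! Grover's algorithm on `N` items of which `t` are marked rotates a plane by `2θ` per iteration,
where `sin θ ^ 2 = t / N`. If the number of iterations is uniform below some `M ≥ 1 / sin θ`, the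
measured item is marked with probability at least `1 / 4` (`quarter_le_sum_sin_sq_odd`), and a
marked outcome is uniform among the marked items. Hence an exponential search has expected cost at
most `36 √(N / t)`, and the next Dürr–Høyer threshold is a uniformly random better item. Two
potentials encode this: `searchPotential` for the rounds of one search and `thresholdPotential`,
bounded by `2`, for the successive thresholds. The loop with budget `b` satisfies `b * Pr[failure] ≤
potential` (`mul_failure_durrHoyerLoop_le`), a Markov inequality proved by induction on the budget.
As the initial potential is at most `72 √N` and the budget at least `256 √N`, a run fails with
probability at most `1 / 2`.

Errors are one-sided. A first-one search returns only fresh entries or `none`, and a maximum is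
never overestimated; so a repeated search fails only if all its runs fail, with probability at most
`2 ^ -numReps n ≤ 1 / n ^ 2`. If every search is correct, the whole computation is deterministic.
Its depth-first search uses at most `2 n` first-one searches and its relaxation at most `n` maxima,
and a union bound gives the error `3 / n`. The deterministic run is correct by the usual arguments:
unfinished vertices are never reachable from the vertex being explored, so finishing times give a
topological order, and the longest path values satisfy a recursion over the last edge.

The running time cannot be conditioned on correctness. It is amortized: the expected cost of a
first-one search is of order `numReps n * √D`, where `D` is the distance to the first fresh entry,
and any fresh entry that may be returned lies at least that far. Instead of the Cauchy–Schwarz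
inequality, the linear bound `√k ≤ α k + 1 / α` with `α = √(n / m)` is used. The terms `α k` add up
to at most `α` times the out-degree along each list, and the terms `1 / α` are paid twice per
non-sink: once for the search that finds it and once for the unsuccessful search that ends its scan.
Every vertex also carries a weight for its later relaxation, so the same potential (`sortPotential`)
bounds the main loop on every order the sort may produce. -/

/-! ## Expectations of probability mass functions and of programs -/

/-- The expectation of a nonnegative function. -/
noncomputable def PMF.expect {α : Type*} (p : PMF α) (g : α → ℝ≥0∞) : ℝ≥0∞ := ∑' a, p a * g a

namespace PMF

variable {α β : Type*}

theorem expect_pure (a : α) (g : α → ℝ≥0∞) : (PMF.pure a).expect g = g a := by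
  rw [expect, tsum_eq_single a]
  · simp
  · intro b hb; simp [hb]

theorem expect_bind (p : PMF α) (f : α → PMF β) (g : β → ℝ≥0∞) :
    (p.bind f).expect g = p.expect fun a => (f a).expect g := by
  simp only [expect, PMF.bind_apply, ← ENNReal.tsum_mul_right, ← ENNReal.tsum_mul_left]
  rw [ENNReal.tsum_comm]
  simp only [mul_assoc]

theorem expect_map (p : PMF α) (f : α → β) (g : β → ℝ≥0∞) :
    (p.map f).expect g = p.expect fun a => g (f a) := by
  simp only [PMF.map, expect_bind, Function.comp, expect_pure]

theorem expect_mono {p : PMF α} {g h : α → ℝ≥0∞} (H : ∀ a, p a ≠ 0 → g a ≤ h a) :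
    p.expect g ≤ p.expect h := by
  refine ENNReal.tsum_le_tsum fun a => ?_
  by_cases ha : p a = 0
  · simp [ha]
  · gcongr
    exact H a ha

theorem expect_add (p : PMF α) (g h : α → ℝ≥0∞) :
    (p.expect fun a => g a + h a) = p.expect g + p.expect h := by
  simp only [expect, mul_add, ENNReal.tsum_add]

theorem expect_const_mul (p : PMF α) (c : ℝ≥0∞) (g : α → ℝ≥0∞) :
    (p.expect fun a => c * g a) = c * p.expect g := by
  simp only [expect, ← ENNReal.tsum_mul_left]
  exact tsum_congr fun a => by ring

theorem expect_const (p : PMF α) (c : ℝ≥0∞) : (p.expect fun _ => c) = c := by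
  simp only [expect, ENNReal.tsum_mul_right, PMF.tsum_coe, one_mul]

theorem expect_uniformOfFinset (S : Finset α) (hS : S.Nonempty) (g : α → ℝ≥0∞) :
    (uniformOfFinset S hS).expect g = (S.card : ℝ≥0∞)⁻¹ * ∑ a ∈ S, g a := by
  rw [expect, tsum_eq_sum (s := S), Finset.mul_sum]
  · refine Finset.sum_congr rfl fun a ha => ?_
    rw [uniformOfFinset_apply_of_mem hS ha]
  · intro a ha
    rw [uniformOfFinset_apply_of_notMem hS ha, zero_mul]

end PMF

/-! ### Expected cost, sure properties and failure probability of programs -/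

namespace QProg

variable {I A α β : Type} [AddGroup A] (x : I → A)

/-- The expectation of a function of the value returned by a program. -/
noncomputable def expect (P : QProg I A α) (g : α → ℝ≥0∞) : ℝ≥0∞ := (P.run x).expect fun r => g r.1

theorem expectedQueries_eq (P : QProg I A α) :
    P.expectedQueries x = (P.run x).expect fun r => (r.2 : ℝ≥0∞) := rfl

/-- All values that the program can return satisfy `Q`. -/
def Surely (P : QProg I A α) (Q : α → Prop) : Prop := ∀ r ∈ (P.run x).support, Q r.1

variable {x}

theorem run_bind (P : QProg I A α) (k : α → QProg I A β) :
    (P.bind k).run x =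
      (P.run x).bind fun r => ((k r.1).run x).map fun r' => (r'.1, r.2 + r'.2) := by
  induction P with
  | ret a =>
    simp only [bind, run, PMF.pure_bind, zero_add]
    exact (PMF.map_id _).symm
  | rand S hS f ih => simp [bind, run, ih]
  | query i f ih =>
    simp only [bind, run, ih, PMF.map_bind, PMF.bind_map, PMF.map_comp, Function.comp_def]
    simp only [add_assoc, add_comm, add_left_comm]
  | exec c f ih =>
    simp only [bind, run, ih, PMF.map_bind, PMF.bind_map, PMF.map_comp, PMF.bind_bind,
      Function.comp_def]
    simp only [add_assoc, add_comm, add_left_comm]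

theorem expect_bind (P : QProg I A α) (k : α → QProg I A β) (g : β → ℝ≥0∞) :
    (P.bind k).expect x g = P.expect x fun a => (k a).expect x g := by
  simp [expect, run_bind, PMF.expect_bind, PMF.expect_map]

theorem expectedQueries_bind (P : QProg I A α) (k : α → QProg I A β) :
    (P.bind k).expectedQueries x =
      P.expectedQueries x + P.expect x fun a => (k a).expectedQueries x := by
  simp only [expectedQueries_eq, expect, run_bind, PMF.expect_bind, PMF.expect_map, Nat.cast_add,
    PMF.expect_add, PMF.expect_const]

theorem surely_bind {P : QProg I A α} {k : α → QProg I A β} {Q : α → Prop} {R : β → Prop}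
    (hP : P.Surely x Q) (hk : ∀ a, Q a → (k a).Surely x R) : (P.bind k).Surely x R := by
  intro r hr
  rw [run_bind, PMF.mem_support_bind_iff] at hr
  obtain ⟨r₁, h₁, h₂⟩ := hr
  rw [PMF.mem_support_map_iff] at h₂
  obtain ⟨r₂, h₃, rfl⟩ := h₂
  exact hk _ (hP _ h₁) r₂ h₃

theorem Surely.mono {P : QProg I A α} {Q R : α → Prop} (hP : P.Surely x Q)
    (h : ∀ a, Q a → R a) : P.Surely x R := fun r hr => h _ (hP r hr)

theorem surely_true (P : QProg I A α) : P.Surely x fun _ => True := fun _ _ => trivial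

theorem surely_ret {a : α} {Q : α → Prop} (h : Q a) : (ret a : QProg I A α).Surely x Q := by
  intro r hr
  simp only [run, PMF.support_pure, Set.mem_singleton_iff] at hr
  rwa [hr]

theorem expect_mono_of_surely {P : QProg I A α} {Q : α → Prop} (hP : P.Surely x Q)
    {g h : α → ℝ≥0∞} (H : ∀ a, Q a → g a ≤ h a) : P.expect x g ≤ P.expect x h :=
  PMF.expect_mono fun r hr => H _ (hP r ((PMF.mem_support_iff _ _).2 hr))

theorem expect_mono {P : QProg I A α} {g h : α → ℝ≥0∞} (H : ∀ a, g a ≤ h a) :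
    P.expect x g ≤ P.expect x h := PMF.expect_mono fun r _ => H r.1

theorem expect_add (P : QProg I A α) (g h : α → ℝ≥0∞) :
    (P.expect x fun a => g a + h a) = P.expect x g + P.expect x h := PMF.expect_add _ _ _

theorem expect_const_mul (P : QProg I A α) (c : ℝ≥0∞) (g : α → ℝ≥0∞) :
    (P.expect x fun a => c * g a) = c * P.expect x g := PMF.expect_const_mul _ _ _

theorem expect_const (P : QProg I A α) (c : ℝ≥0∞) : (P.expect x fun _ => c) = c :=
  PMF.expect_const _ _

theorem expect_le_const {P : QProg I A α} {g : α → ℝ≥0∞} {c : ℝ≥0∞} (H : ∀ a, g a ≤ c) :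
    P.expect x g ≤ c := (expect_mono H).trans (expect_const P c).le

theorem expect_ret (a : α) (g : α → ℝ≥0∞) : (ret a : QProg I A α).expect x g = g a :=
  PMF.expect_pure _ _

theorem expectedQueries_ret (a : α) : (ret a : QProg I A α).expectedQueries x = 0 := by
  simp [expectedQueries_eq, run, PMF.expect_pure]

theorem expect_draw (S : Finset α) (hS : S.Nonempty) (g : α → ℝ≥0∞) :
    (draw S hS : QProg I A α).expect x g = (S.card : ℝ≥0∞)⁻¹ * ∑ a ∈ S, g a := by
  simp only [expect, draw, run, PMF.expect_bind, PMF.expect_pure, PMF.expect_uniformOfFinset]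

theorem expectedQueries_draw (S : Finset α) (hS : S.Nonempty) :
    (draw S hS : QProg I A α).expectedQueries x = 0 := by
  simp only [expectedQueries_eq, draw, run, PMF.expect_bind, PMF.expect_pure]
  simpa using PMF.expect_const (PMF.uniformOfFinset S hS) 0

theorem surely_draw (S : Finset α) (hS : S.Nonempty) :
    (draw S hS : QProg I A α).Surely x (· ∈ S) := by
  intro r hr
  simp only [draw, run, PMF.mem_support_bind_iff, PMF.mem_support_uniformOfFinset_iff,
    PMF.support_pure, Set.mem_singleton_iff] at hr
  obtain ⟨b, hb, rfl⟩ := hr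
  exact hb

theorem expect_ask (i : I) (g : A → ℝ≥0∞) : (ask i : QProg I A A).expect x g = g (x i) := by
  simp only [expect, ask, run, PMF.expect_map, PMF.expect_pure]

theorem expectedQueries_ask (i : I) : (ask i : QProg I A A).expectedQueries x = 1 := by
  simp [expectedQueries_eq, ask, run, PMF.expect_map, PMF.expect_pure]

theorem surely_ask (i : I) : (ask i : QProg I A A).Surely x (· = x i) := by
  intro r hr
  simp only [ask, run, PMF.mem_support_map_iff, PMF.support_pure, Set.mem_singleton_iff] at hr
  obtain ⟨b, rfl, rfl⟩ := hr
  rfl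

theorem expect_measureIndex (c : QCircuit I A) (g : I → ℝ≥0∞) :
    (measureIndex c : QProg I A I).expect x g = (c.measure x).expect fun b => g b.1 := by
  simp only [expect, measureIndex, run, PMF.expect_bind, PMF.expect_map, PMF.expect_pure]

theorem expectedQueries_measureIndex (c : QCircuit I A) :
    (measureIndex c : QProg I A I).expectedQueries x = c.queries := by
  simp only [expectedQueries_eq, measureIndex, run, PMF.expect_bind, PMF.expect_map,
    PMF.expect_pure, zero_add, PMF.expect_const]

theorem surely_measureIndex (c : QCircuit I A) (Q : I → Prop)
    (h : ∀ b, c.measure x b ≠ 0 → Q b.1) : (measureIndex c : QProg I A I).Surely x Q := by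
  intro r hr
  simp only [measureIndex, run, PMF.mem_support_bind_iff, PMF.mem_support_map_iff,
    PMF.support_pure, Set.mem_singleton_iff] at hr
  obtain ⟨b, hb, b', rfl, rfl⟩ := hr
  exact h b hb

theorem expectedQueries_bind_le {P : QProg I A α} {k : α → QProg I A β} {Q : α → Prop}
    {c : ℝ≥0∞} (hP : P.Surely x Q) (hk : ∀ a, Q a → (k a).expectedQueries x ≤ c) :
    (P.bind k).expectedQueries x ≤ P.expectedQueries x + c := by
  rw [expectedQueries_bind]
  gcongr
  exact (expect_mono_of_surely hP hk).trans (expect_const P c).le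

open Classical in
/-- The probability that the program returns a value that does not satisfy `Q`. -/
noncomputable def failure (x : I → A) (P : QProg I A α) (Q : α → Prop) : ℝ≥0∞ :=
  P.expect x fun a => if Q a then 0 else 1

theorem failure_eq_expect (P : QProg I A α) (Q : α → Prop) [DecidablePred Q] :
    P.failure x Q = P.expect x fun a => if Q a then 0 else 1 := by
  rw [failure]
  congr!

theorem errorProb_eq_failure (P : QProg I A α) (S : Set α) :
    P.errorProb x S = P.failure x (· ∈ S) := by
  classical
  rw [errorProb, PMF.toOuterMeasure_apply, failure, expect, PMF.expect]
  refine tsum_congr fun r => ?_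
  by_cases h : r.1 ∈ S <;> simp [h]

theorem failure_le_one (P : QProg I A α) (Q : α → Prop) : P.failure x Q ≤ 1 :=
  expect_le_const fun a => by split_ifs <;> simp

theorem failure_eq_zero {P : QProg I A α} {Q : α → Prop} (h : P.Surely x Q) :
    P.failure x Q = 0 := by
  refine le_antisymm ?_ bot_le
  exact (expect_mono_of_surely h fun a ha => by simp [ha]).trans (expect_const P 0).le

theorem failure_mono {P : QProg I A α} {Q R : α → Prop} (h : ∀ a, Q a → R a) :
    P.failure x R ≤ P.failure x Q := by
  refine expect_mono fun a => ?_
  by_cases hq : Q a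
  · simp [hq, h a hq]
  · simp only [hq, if_false]
    split_ifs <;> simp

theorem failure_mono_of_surely {P : QProg I A α} {S Q R : α → Prop} (hP : P.Surely x S)
    (h : ∀ a, S a → Q a → R a) : P.failure x R ≤ P.failure x Q := by
  refine expect_mono_of_surely hP fun a hs => ?_
  by_cases hq : Q a
  · simp [hq, h a hs hq]
  · simp only [hq, if_false]
    split_ifs <;> simp

/-- The union bound for sequential composition. -/
theorem failure_bind_le {P : QProg I A α} {k : α → QProg I A β} {Q : α → Prop} {R : β → Prop}
    {c d : ℝ≥0∞} (hP : P.failure x Q ≤ c) (hk : ∀ a, Q a → (k a).failure x R ≤ d) :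
    (P.bind k).failure x R ≤ c + d := by
  classical
  rw [failure, expect_bind]
  calc (P.expect x fun a => (k a).failure x R)
      ≤ P.expect x fun a => (if Q a then 0 else 1) + d := by
        refine expect_mono fun a => ?_
        by_cases h : Q a
        · simpa [h] using hk a h
        · simpa [h] using (failure_le_one _ _).trans le_self_add
    _ ≤ c + d := by
        rw [expect_add, expect_const]
        gcongr
        exact hP

theorem failure_ret {a : α} {Q : α → Prop} (h : Q a) : (ret a : QProg I A α).failure x Q = 0 :=
  failure_eq_zero (surely_ret h)

/-! ### Repetitions -/

omit [AddGroup A] in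
theorem boost_succ (op : α → α → α) (e : α) (P : QProg I A α) (k : ℕ) :
    boost op e P (k + 1) = P.bind fun a => (boost op e P k).bind fun b => ret (op a b) := rfl

theorem expectedQueries_boost (op : α → α → α) (e : α) (P : QProg I A α) (k : ℕ) :
    (boost op e P k).expectedQueries x = k * P.expectedQueries x := by
  induction k with
  | zero => simp [boost, expectedQueries_ret]
  | succ k ih =>
    simp only [boost_succ, expectedQueries_bind, expectedQueries_ret, expect_const, ih, add_zero]
    push_cast
    ring

theorem surely_boost {op : α → α → α} {e : α} {P : QProg I A α} {Q : α → Prop}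
    (hP : P.Surely x Q) (he : Q e) (hop : ∀ a b, Q a → Q b → Q (op a b)) (k : ℕ) :
    (boost op e P k).Surely x Q := by
  induction k with
  | zero => exact surely_ret he
  | succ k ih =>
    exact surely_bind hP fun a ha => surely_bind ih fun b hb => surely_ret (hop a b ha hb)

/-- If the correct value absorbs all others, then the error probability of `k` repetitions is
the `k`-th power of the error probability of one run. -/
theorem failure_boost_le {op : α → α → α} {e : α} {P : QProg I A α} {Q : α → Prop} {c : α}
    (hP : P.Surely x Q) (he : Q e) (hop : ∀ a b, Q a → Q b → Q (op a b))
    (hl : ∀ b, Q b → op c b = c) (hr : ∀ b, Q b → op b c = c) (k : ℕ) :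
    (boost op e P k).failure x (· = c) ≤ P.failure x (· = c) ^ k := by
  classical
  induction k with
  | zero => simpa using failure_le_one _ _
  | succ k ih =>
    have hB := surely_boost hP he hop k
    rw [boost_succ, failure, expect_bind, pow_succ']
    calc _ ≤ P.expect x fun a => (if a = c then 0 else 1) * P.failure x (· = c) ^ k := by
            refine expect_mono_of_surely hP fun a ha => ?_
            -- A correct first run is absorbing, so nothing later can fail; after a wrong one,
            -- failure still requires the remaining runs to be wrong.
            by_cases h : a = c
            · subst h
              rw [expect_bind]
              refine (expect_mono_of_surely (h := fun _ => 0) hB fun b hb => ?_).trans ?_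
              · simp [expect_ret, hl b hb]
              · simp [expect_const]
            · simp only [h, if_false, one_mul]
              refine le_trans ?_ ih
              rw [expect_bind]
              refine expect_mono_of_surely hB fun b hb => ?_
              rw [expect_ret]
              by_cases hbc : b = c
              · simp [hbc, hr a ha]
              · simp only [hbc, if_false]
                split_ifs <;> simp
      _ = _ := by
            simp only [mul_comm _ (P.failure x (· = c) ^ k), expect_const_mul]
            rfl

end QProg

/-! ## The state of Grover's algorithm -/

section Grover

variable {I A : Type} [AddGroup A]

/-- The state is a superposition of the basis states `|i⟩|0⟩`, `i ∈ P`, with the amplitudes `c i`. -/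
def HasAmplitudes (P : Finset I) (c : I → ℂ) (ψ : QState (I × A × Unit)) : Prop :=
  ∀ i z, ψ (i, z, ()) = by classical exact if i ∈ P ∧ z = 0 then c i else 0

theorem hasAmplitudes_uniformState (P : Finset I) :
    HasAmplitudes P (fun _ => (((√(P.card : ℝ))⁻¹ : ℝ) : ℂ)) (uniformState A P) := by
  classical
  intro i z
  simp only [uniformState, lp.coeFn_sum, Finset.sum_apply, lp.coeFn_single, Pi.single_apply,
    Finset.sum_ite_eq]
  refine if_congr ?_ rfl rfl
  simp [searchBasis, eq_comm]

theorem inner_uniformState {P : Finset I} {c : I → ℂ} {ψ : QState (I × A × Unit)}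
    (h : HasAmplitudes P c ψ) :
    inner ℂ (uniformState A P) ψ = (((√(P.card : ℝ))⁻¹ : ℝ) : ℂ) * ∑ i ∈ P, c i := by
  classical
  rw [uniformState, sum_inner, searchBasis, Finset.sum_image
    (fun i _ j _ hij => congrArg Prod.fst hij), Finset.mul_sum]
  refine Finset.sum_congr rfl fun i hi => ?_
  rw [lp.inner_single_left, h i 0]
  simp [hi, mul_comm]

/-- On amplitudes, `2|u⟩⟨u| - 1` is the inversion about the mean over `P`. -/
theorem hasAmplitudes_reflection {P : Finset I} (hP : P.Nonempty) {c : I → ℂ}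
    {ψ : QState (I × A × Unit)} (h : HasAmplitudes P c ψ) :
    HasAmplitudes P (fun i => 2 * (P.card : ℂ)⁻¹ * ∑ k ∈ P, c k - c i)
      ((ℂ ∙ uniformState A P).reflection ψ) := by
  classical
  intro i z
  have hs : (((√(P.card : ℝ))⁻¹ : ℝ) : ℂ) * (((√(P.card : ℝ))⁻¹ : ℝ) : ℂ) = (P.card : ℂ)⁻¹ := by
    rw [← Complex.ofReal_mul, ← mul_inv, Real.mul_self_sqrt (Nat.cast_nonneg _)]
    simp
  rw [Submodule.reflection_apply, Submodule.starProjection_unit_singleton ℂ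
    (norm_uniformState P hP), inner_uniformState h]
  simp only [two_smul, lp.coeFn_add, lp.coeFn_sub, lp.coeFn_smul, Pi.add_apply, Pi.sub_apply,
    Pi.smul_apply, smul_eq_mul, h i z, hasAmplitudes_uniformState P i z]
  split_ifs
  · rw [← hs]; ring
  · simp

/-- The first call writes `x i` into the zero answer register, where the sign flip sees it; the
negation turns it into `-x i`, and the second call clears it. The answer register is zero again and
only the signs of the marked amplitudes have changed. -/
theorem hasAmplitudes_groverIteration {P : Finset I} (hP : P.Nonempty) (mark : I → A → Prop)
    [∀ i a, Decidable (mark i a)] (x : I → A) {c : I → ℂ} {ψ : QState (I × A × Unit)} (h : HasAmplitudes P c ψ) :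
    HasAmplitudes P
      (fun i => 2 * (P.card : ℂ)⁻¹ * ∑ k ∈ P, (if mark k (x k) then -c k else c k)
        - (if mark i (x i) then -c i else c i))
      ((groverIteration P mark).foldl (fun ψ U => U (oracleUnitary x ψ)) ψ) := by
  refine hasAmplitudes_reflection (c := fun i => if mark i (x i) then -c i else c i) hP ?_
  intro i z
  change (@ite _ (mark i (-(z - x i))) (Classical.propDecidable _) (-ψ (i, -(z - x i) - x i, ()))
    (ψ (i, -(z - x i) - x i, ()))) = _
  have hz : -(z - x i) - x i = 0 ↔ z = 0 := by
    rw [neg_sub, sub_eq_zero, sub_eq_iff_eq_add, left_eq_add]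
  rw [h i, hz]
  by_cases h0 : i ∈ P ∧ z = 0
  · simp [h0]
  · simp [h0]

variable {P : Finset I} {hP : P.Nonempty} {mark : I → A → Prop} {x : I → A}

theorem finalState_groverCircuit_succ (j : ℕ) :
    (groverCircuit P hP mark (j + 1)).finalState x =
      (groverIteration P mark).foldl (fun ψ U => U (oracleUnitary x ψ))
        ((groverCircuit P hP mark j).finalState x) := by
  simp only [QCircuit.finalState, groverCircuit, List.replicate_succ', List.flatten_append,
    List.flatten_singleton]
  exact List.foldl_append

theorem queries_groverCircuit (j : ℕ) : (groverCircuit P hP mark j).queries = 2 * j := by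
  have h : ((List.replicate j (groverIteration P mark)).flatten).length = 2 * j := by
    rw [List.length_flatten, List.map_replicate, List.sum_replicate, smul_eq_mul, mul_comm]
    rfl
  exact h

theorem exists_hasAmplitudes_groverCircuit (j : ℕ) :
    ∃ c : I → ℂ, HasAmplitudes P c ((groverCircuit P hP mark j).finalState x) := by
  induction j with
  | zero => exact ⟨_, hasAmplitudes_uniformState P⟩
  | succ j ih =>
    obtain ⟨c, hc⟩ := ih
    rw [finalState_groverCircuit_succ]
    classical
    exact ⟨_, hasAmplitudes_groverIteration hP mark x hc⟩

theorem surely_measureIndex_groverCircuit (j : ℕ) :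
    (QProg.measureIndex (groverCircuit P hP mark j)).Surely x (· ∈ P) := by
  obtain ⟨c, hc⟩ := exists_hasAmplitudes_groverCircuit (hP := hP) (mark := mark) (x := x) j
  refine QProg.surely_measureIndex _ _ fun b hb => ?_
  by_contra hbP
  refine hb ?_
  change ENNReal.ofReal (‖(groverCircuit P hP mark j).finalState x b‖ ^ 2) = 0
  have := hc b.1 b.2.1
  rw [show b = (b.1, b.2.1, ()) from rfl, this]
  simp [hbP]

theorem expect_measureIndex_groverCircuit {j : ℕ} {c : I → ℂ}
    (hc : HasAmplitudes P c ((groverCircuit P hP mark j).finalState x)) (g : I → ℝ≥0∞) :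
    (QProg.measureIndex (groverCircuit P hP mark j)).expect x g =
      ∑ i ∈ P, ENNReal.ofReal (‖c i‖ ^ 2) * g i := by
  classical
  rw [QProg.expect_measureIndex]
  -- The workspace of the circuit unfolds to `Unit`, so the sum can be restricted to the finite set
  -- `searchBasis A P` that supports the state.
  change ∑' b : I × A × Unit, ENNReal.ofReal
    (‖((groverCircuit P hP mark j).finalState x : QState (I × A × Unit)) b‖ ^ 2) * g b.1 = _
  rw [tsum_eq_sum (s := searchBasis A P), searchBasis,
    Finset.sum_image (fun i _ j _ hij => congrArg Prod.fst hij)]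
  · refine Finset.sum_congr rfl fun i hi => ?_
    rw [hc i 0]
    simp [hi]
  · rintro ⟨i, z, _⟩ hb
    have : ¬ (i ∈ P ∧ z = 0) := by
      rintro ⟨h1, rfl⟩
      exact hb (by simp [searchBasis, h1])
    rw [hc i z]
    simp [this]

/-- The amplitudes after `j` Grover iterations: those of the marked positions are proportional to
`sin ((2 j + 1) θ)`, the others to `cos ((2 j + 1) θ)`. -/
theorem hasAmplitudes_groverCircuit [∀ i a, Decidable (mark i a)] {t : ℕ} {θ : ℝ}
    (ht : (P.filter fun i => mark i (x i)).card = t) (hsin : Real.sin θ ≠ 0)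
    (hcos : Real.cos θ ≠ 0) (hθ : (t : ℝ) = P.card * Real.sin θ ^ 2) (j : ℕ) :
    HasAmplitudes P
      (fun i => ((if mark i (x i) then
          Real.sin ((2 * j + 1) * θ) / (√(P.card : ℝ) * Real.sin θ) else
          Real.cos ((2 * j + 1) * θ) / (√(P.card : ℝ) * Real.cos θ) : ℝ) : ℂ))
      ((groverCircuit P hP mark j).finalState x) := by
  have hN : (0 : ℝ) < P.card := by exact_mod_cast hP.card_pos
  have hr : √(P.card : ℝ) ≠ 0 := (Real.sqrt_pos.2 hN).ne'
  induction j with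
  | zero =>
    have := hasAmplitudes_uniformState (A := A) P
    refine fun i z => (this i z).trans ?_
    congr 1
    refine congrArg _ ?_
    split_ifs
    · rw [Nat.cast_zero, mul_zero, zero_add, one_mul]; field_simp
    · rw [Nat.cast_zero, mul_zero, zero_add, one_mul]; field_simp
  | succ j ih =>
    rw [finalState_groverCircuit_succ]
    refine fun i z => (hasAmplitudes_groverIteration hP mark x ih i z).trans ?_
    congr 1
    set a : ℝ := (2 * j + 1) * θ with ha
    -- The unmarked positions number `N cos² θ`, since the marked ones number `N sin² θ`.
    have hc : (((P.filter fun i => ¬ mark i (x i)).card : ℕ) : ℝ) = P.card * Real.cos θ ^ 2 := by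
      have h1 := P.card_filter_add_card_filter_not (fun i => mark i (x i))
      have h2 : (t : ℝ) + (((P.filter fun i => ¬ mark i (x i)).card : ℕ) : ℝ) = P.card := by
        rw [← ht]; exact_mod_cast h1
      have h3 := Real.sin_sq_add_cos_sq θ
      linear_combination h2 - hθ - P.card * h3
    have hsum : ∑ k ∈ P, (if mark k (x k) then
        -(((if mark k (x k) then Real.sin a / (√(P.card : ℝ) * Real.sin θ) else
          Real.cos a / (√(P.card : ℝ) * Real.cos θ) : ℝ)) : ℂ) else
        (((if mark k (x k) then Real.sin a / (√(P.card : ℝ) * Real.sin θ) else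
          Real.cos a / (√(P.card : ℝ) * Real.cos θ) : ℝ)) : ℂ)) =
        ((P.card * (Real.cos θ * Real.cos a - Real.sin θ * Real.sin a) / √(P.card : ℝ) : ℝ) : ℂ) := by
      rw [← Finset.sum_filter_add_sum_filter_not P (fun k => mark k (x k))]
      rw [Finset.sum_congr (g := fun _ => ((-(Real.sin a / (√(P.card : ℝ) * Real.sin θ)) : ℝ) : ℂ))
        rfl fun k hk => by simp [(Finset.mem_filter.1 hk).2]]
      rw [Finset.sum_congr (s₁ := P.filter fun k => ¬ mark k (x k))
        (g := fun _ => ((Real.cos a / (√(P.card : ℝ) * Real.cos θ) : ℝ) : ℂ))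
        rfl fun k hk => by simp [(Finset.mem_filter.1 hk).2]]
      rw [Finset.sum_const, Finset.sum_const, ht, nsmul_eq_mul, nsmul_eq_mul]
      rw [← Complex.ofReal_natCast, ← Complex.ofReal_natCast, hc, hθ]
      norm_cast
      field_simp
      ring
    have hb : (2 * ((j + 1 : ℕ) : ℝ) + 1) * θ = a + 2 * θ := by rw [ha]; push_cast; ring
    rw [hsum, hb]
    have h3 := Real.sin_sq_add_cos_sq θ
    -- The addition formulas are arranged as the inversion about the mean produces them: one
    -- iteration turns the angle `a` into `a + 2 θ`.
    have hs2 : Real.sin (a + 2 * θ) =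
        Real.sin a * (1 - 2 * Real.sin θ ^ 2) + Real.cos a * (2 * Real.sin θ * Real.cos θ) := by
      rw [Real.sin_add, Real.cos_two_mul, Real.sin_two_mul]
      linear_combination 2 * Real.sin a * h3
    have hc2 : Real.cos (a + 2 * θ) =
        Real.cos a * (2 * Real.cos θ ^ 2 - 1) - Real.sin a * (2 * Real.sin θ * Real.cos θ) := by
      rw [Real.cos_add, Real.cos_two_mul, Real.sin_two_mul]
    by_cases hm : mark i (x i)
    · simp only [hm, if_true]
      rw [hs2, ← Complex.ofReal_natCast]
      norm_cast
      field_simp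
      ring
    · simp only [hm, if_false]
      rw [hc2, ← Complex.ofReal_natCast]
      norm_cast
      field_simp
      ring

end Grover

/-! ## The average success probability of Grover's search -/

/-- The factor `sin (2θ)` makes the sum telescope; keeping it on the left avoids a division. -/
theorem sum_sin_sq_odd (θ : ℝ) (M : ℕ) :
    4 * Real.sin (2 * θ) * ∑ j ∈ Finset.range M, Real.sin ((2 * j + 1) * θ) ^ 2 =
      2 * M * Real.sin (2 * θ) - Real.sin (4 * M * θ) := by
  induction M with
  | zero => simp
  | succ M ih =>
    rw [Finset.sum_range_succ, mul_add, ih]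
    set a := (2 * (M : ℝ) + 1) * θ with ha
    have h1 : Real.sin (4 * (M : ℝ) * θ) = Real.sin (2 * a - 2 * θ) := by congr 1; rw [ha]; ring
    have h2 : Real.sin (4 * ((M + 1 : ℕ) : ℝ) * θ) = Real.sin (2 * a + 2 * θ) := by
      congr 1; rw [ha]; push_cast; ring
    have h3 : Real.cos (2 * a) = 1 - 2 * Real.sin a ^ 2 := by
      rw [Real.cos_two_mul, ← Real.sin_sq_add_cos_sq a]; ring
    rw [h1, h2, Real.sin_sub, Real.sin_add, h3]
    push_cast
    ring

/-- If the number of Grover iterations is drawn uniformly below `M ≥ 1 / sin θ`, the search succeeds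
with probability at least `1 / 4`. -/
theorem quarter_le_sum_sin_sq_odd {θ : ℝ} (h0 : 0 < θ) (h1 : θ < Real.pi / 2) {M : ℕ}
    (hM : 1 ≤ M * Real.sin θ) :
    (M : ℝ) / 4 ≤ ∑ j ∈ Finset.range M, Real.sin ((2 * j + 1) * θ) ^ 2 := by
  have hs : 0 < Real.sin (2 * θ) := Real.sin_pos_of_pos_of_lt_pi (by linarith) (by linarith)
  -- By the closed form of the sum, this inequality is equivalent to the claim. Up to `π / 4` it
  -- follows from `M sin (2θ) = 2 M sin θ cos θ ≥ 1`. Near `π / 2` the hypothesis on `M sin θ` says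
  -- little, and the complementary angle `φ` is used.
  have key : Real.sin (4 * M * θ) ≤ M * Real.sin (2 * θ) := by
    rcases le_total θ (Real.pi / 4) with h | h
    · have hc : 1 / 2 ≤ Real.cos θ := by
        rw [← Real.cos_pi_div_three]
        exact Real.cos_le_cos_of_nonneg_of_le_pi h0.le (by linarith [Real.pi_pos])
          (by linarith [Real.pi_pos])
      rw [Real.sin_two_mul]
      have := Real.sin_le_one (4 * M * θ)
      nlinarith
    · set φ := Real.pi / 2 - θ with hφ
      have e1 : Real.sin (4 * M * θ) = -Real.sin (4 * M * φ) := by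
        rw [show 4 * (M : ℝ) * θ = (M : ℝ) * (2 * Real.pi) - 4 * M * φ by rw [hφ]; ring,
          Real.sin_nat_mul_two_pi_sub]
      have e2 : Real.sin (2 * θ) = Real.sin (2 * φ) := by
        rw [show 2 * θ = Real.pi - 2 * φ by rw [hφ]; ring, Real.sin_pi_sub]
      have hφ0 : 0 < φ := by linarith
      rw [e1]
      -- Either the left side is at most zero, or `φ` is so large that Jordan's inequality makes the
      -- right side at least `1`.
      rcases le_total (4 * M * φ) Real.pi with h' | h'
      · have : 0 ≤ Real.sin (4 * M * φ) :=
          Real.sin_nonneg_of_nonneg_of_le_pi (by positivity) h'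
        have : 0 ≤ (M : ℝ) * Real.sin (2 * θ) := by positivity
        linarith
      · have h3 : 2 / Real.pi * (2 * φ) ≤ Real.sin (2 * φ) :=
          Real.mul_le_sin (by linarith) (by linarith)
        have h4 : 1 ≤ M * (2 / Real.pi * (2 * φ)) := by
          rw [show (M : ℝ) * (2 / Real.pi * (2 * φ)) = (4 * M * φ) / Real.pi by ring,
            le_div_iff₀ Real.pi_pos]
          linarith
        have h5 : M * (2 / Real.pi * (2 * φ)) ≤ M * Real.sin (2 * φ) := by gcongr
        rw [e2]
        linarith [Real.neg_one_le_sin (4 * M * φ)]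
  have := sum_sin_sq_odd θ M
  by_contra! hcon
  nlinarith

/-! ## Potential functions for the Dürr–Høyer maximum -/

/-- The expected cost of the searches by which a threshold with `t` better items is improved to the
maximum, as a multiple of `36 √N`. -/
noncomputable def thresholdPotential (t : ℕ) : ℝ :=
  ∑ k ∈ Finset.range t, (√((k + 1 : ℕ) : ℝ) - √(k : ℝ)) / ((k + 1 : ℕ) : ℝ)

theorem thresholdPotential_mono : Monotone thresholdPotential := by
  refine monotone_nat_of_le_succ fun t => ?_
  rw [thresholdPotential, thresholdPotential, Finset.sum_range_succ, le_add_iff_nonneg_right]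
  have : √(t : ℝ) ≤ √((t + 1 : ℕ) : ℝ) := Real.sqrt_le_sqrt (by push_cast; linarith)
  exact div_nonneg (by linarith) (by positivity)

theorem thresholdPotential_nonneg (t : ℕ) : 0 ≤ thresholdPotential t := by
  simpa [thresholdPotential] using thresholdPotential_mono (Nat.zero_le t)

/-- Divided by `t`, this is the recursion behind the potential: with `t` better items, pay `1 / √t`
for one search and then the mean over the ranks `0, …, t - 1` of the new threshold. -/
theorem sum_thresholdPotential (t : ℕ) :
    ∑ k ∈ Finset.range t, thresholdPotential k = t * thresholdPotential t - √(t : ℝ) := by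
  induction t with
  | zero => simp
  | succ t ih =>
    rw [Finset.sum_range_succ, ih]
    conv_rhs => rw [thresholdPotential, Finset.sum_range_succ, ← thresholdPotential]
    have : ((t + 1 : ℕ) : ℝ) ≠ 0 := by positivity
    field_simp
    push_cast
    ring

/-- With `a = √(t + 1)` and `b = √(t + 2)`, the new term `(b - a) / b ^ 2` is at most `1 / a - 1 /
b`, so the bounds telescope. -/
theorem thresholdPotential_succ_le (t : ℕ) :
    thresholdPotential (t + 1) ≤ 2 - 1 / √((t + 1 : ℕ) : ℝ) := by
  induction t with
  | zero => norm_num [thresholdPotential]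
  | succ t ih =>
    rw [thresholdPotential, Finset.sum_range_succ, ← thresholdPotential]
    set a := √((t + 1 : ℕ) : ℝ) with ha
    set b := √((t + 1 + 1 : ℕ) : ℝ) with hb
    have ha0 : 0 < a := Real.sqrt_pos.2 (by positivity)
    have hab : a ≤ b := Real.sqrt_le_sqrt (by push_cast; linarith)
    have hb0 : 0 < b := ha0.trans_le hab
    have hb2 : ((t + 1 + 1 : ℕ) : ℝ) = b * b := (Real.mul_self_sqrt (by positivity)).symm
    have : (b - a) / ((t + 1 + 1 : ℕ) : ℝ) ≤ 1 / a - 1 / b := by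
      rw [hb2, div_sub_div _ _ ha0.ne' hb0.ne', one_mul, mul_one]
      have : 0 ≤ b - a := by linarith
      gcongr
    linarith

theorem thresholdPotential_le_two (t : ℕ) : thresholdPotential t ≤ 2 := by
  cases t with
  | zero => norm_num [thresholdPotential]
  | succ t =>
    have := thresholdPotential_succ_le t
    have : 0 ≤ 1 / √((t + 1 : ℕ) : ℝ) := by positivity
    linarith

/-- The expected remaining cost in round `r` of an exponential search among `N` items of which
`N / T ^ 2` are marked. -/
noncomputable def searchPotential (T : ℝ) (r : ℕ) : ℝ :=
  if (6 / 5 : ℝ) ^ r < T then 36 * T - 10 * (6 / 5 : ℝ) ^ r else 20 * (6 / 5 : ℝ) ^ r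

theorem searchPotential_nonneg (T : ℝ) (r : ℕ) : 0 ≤ searchPotential T r := by
  have : 0 < (6 / 5 : ℝ) ^ r := by positivity
  rw [searchPotential]
  split_ifs <;> linarith

theorem searchPotential_zero_le {T : ℝ} (hT : 1 ≤ T) : searchPotential T 0 ≤ 36 * T := by
  rw [searchPotential]
  split_ifs
  · norm_num
  · norm_num; linarith

/-- With `X = (6 / 5) ^ r`, a round costs at most `2 X`. Below `T` the term `-10 X` decreases by
exactly `2 X` without any success probability. From `T` on, success has probability at least `1 /
4`, and `2 X + (3 / 4) * 20 * (6 / 5) X = 20 X`. The constant `36` leaves room for the crossing. -/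
theorem searchPotential_step {T p : ℝ} (N r : ℕ) (hp0 : 0 ≤ p)
    (hp : T ≤ (6 / 5 : ℝ) ^ r → 1 / 4 ≤ p) :
    (⌈searchBound N r⌉₊ : ℝ) + (1 - p) * searchPotential T (r + 1) ≤ searchPotential T r := by
  have h1 : 1 ≤ (6 / 5 : ℝ) ^ r := one_le_pow₀ (by norm_num)
  have hM : (⌈searchBound N r⌉₊ : ℝ) ≤ 2 * (6 / 5 : ℝ) ^ r := by
    have h2 := Nat.ceil_lt_add_one (a := searchBound N r)
      (le_min (by positivity) (Real.sqrt_nonneg _))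
    have h3 : searchBound N r ≤ (6 / 5 : ℝ) ^ r := min_le_left _ _
    linarith
  have hn := searchPotential_nonneg T (r + 1)
  simp only [searchPotential, pow_succ] at hn ⊢
  set X := (6 / 5 : ℝ) ^ r
  by_cases hx : X < T
  · rw [if_pos hx]
    split_ifs at hn ⊢ <;> nlinarith
  · rw [if_neg hx]
    have := hp (not_lt.1 hx)
    rw [if_neg (by linarith)] at hn ⊢
    nlinarith

/-- The sum of a monotone function of the number of larger keys. -/
theorem sum_card_lt_le {ι κ : Type*} [LinearOrder κ] (f : ι → κ) {V : ℕ → ℝ} (hV : Monotone V)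
    (S : Finset ι) :
    ∑ z ∈ S, V (S.filter fun j => f z < f j).card ≤ ∑ k ∈ Finset.range S.card, V k := by
  classical
  -- A new smallest element does not change the counts of the others, and its own count is at most
  -- the number of the others; ties make this an inequality.
  induction S using Finset.induction_on_min_value f with
  | empty => simp
  | insert a s ha hmin ih =>
    rw [Finset.sum_insert ha, Finset.card_insert_of_notMem ha, Finset.sum_range_succ, add_comm]
    refine add_le_add (le_trans (le_of_eq ?_) ih) (hV ?_)
    · refine Finset.sum_congr rfl fun z hz => ?_
      rw [Finset.filter_insert, if_neg (not_lt.2 (hmin z hz))]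
    · rw [Finset.filter_insert, if_neg (lt_irrefl _)]
      exact Finset.card_filter_le _ _

/-! ## The Dürr–Høyer maximum -/

section DurrHoyer

variable {I A κ : Type} [AddGroup A] [LinearOrder κ]

theorem durrHoyerLoop_eq (P : Finset I) (hP : P.Nonempty) (key : I → A → κ) (b r : ℕ)
    (y : I × A) :
    durrHoyerLoop P hP key b r y =
      (QProg.draw (Finset.range ⌈searchBound P.card r⌉₊)
        (searchBound_range_nonempty hP.card_pos r)).bind fun j =>
      if 2 * j + 1 ≤ b then
        (QProg.measureIndex (groverCircuit P hP (fun i a => key y.1 y.2 < key i a) j)).bind fun i =>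
        (QProg.ask i).bind fun a =>
        if key y.1 y.2 < key i a then durrHoyerLoop P hP key (b - (2 * j + 1)) 0 (i, a)
        else durrHoyerLoop P hP key (b - (2 * j + 1)) (r + 1) y
      else QProg.ret y := by
  rw [durrHoyerLoop]
  rfl

variable {P : Finset I} {hP : P.Nonempty} {key : I → A → κ} {x : I → A}

/-- The threshold never gets worse. A round spends `2 j + 1 ≥ 1` queries, so induction on the budget
applies. -/
theorem surely_durrHoyerLoop (b : ℕ) : ∀ (r : ℕ) (i : I), i ∈ P →
    (durrHoyerLoop P hP key b r (i, x i)).Surely x fun y =>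
      y.1 ∈ P ∧ y.2 = x y.1 ∧ key i (x i) ≤ key y.1 y.2 := by
  induction b using Nat.strong_induction_on with
  | _ b ih =>
  intro r i hi
  rw [durrHoyerLoop_eq]
  refine QProg.surely_bind (QProg.surely_true _) fun j _ => ?_
  split_ifs with hj
  · refine QProg.surely_bind (surely_measureIndex_groverCircuit j) fun i' hi' => ?_
    refine QProg.surely_bind (QProg.surely_ask i') fun a ha => ?_
    subst ha
    split_ifs with hk
    · exact (ih _ (by omega) 0 i' hi').mono fun y hy => ⟨hy.1, hy.2.1, hk.le.trans hy.2.2⟩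
    · exact ih _ (by omega) (r + 1) i hi
  · exact QProg.surely_ret ⟨hi, rfl, le_rfl⟩

theorem expectedQueries_durrHoyerLoop_le (b : ℕ) : ∀ (r : ℕ) (y : I × A),
    (durrHoyerLoop P hP key b r y).expectedQueries x ≤ b := by
  induction b using Nat.strong_induction_on with
  | _ b ih =>
  intro r y
  rw [durrHoyerLoop_eq]
  refine (QProg.expectedQueries_bind_le (c := b) (QProg.surely_true _) fun j _ => ?_).trans_eq
    (by rw [QProg.expectedQueries_draw, zero_add])
  split_ifs with hj
  · have hb : (b : ℝ≥0∞) = ((2 * j : ℕ) : ℝ≥0∞) + (1 + ((b - (2 * j + 1) : ℕ) : ℝ≥0∞)) := by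
      norm_cast; omega
    rw [hb]
    refine (QProg.expectedQueries_bind_le (QProg.surely_true _) fun i _ => ?_).trans_eq
      (by rw [QProg.expectedQueries_measureIndex, queries_groverCircuit])
    refine (QProg.expectedQueries_bind_le (QProg.surely_true _) fun a _ => ?_).trans_eq
      (by rw [QProg.expectedQueries_ask])
    split_ifs
    · exact ih _ (by omega) _ _
    · exact ih _ (by omega) _ _
  · rw [QProg.expectedQueries_ret]
    exact zero_le

variable (P key x) in
/-- The number of items that are better than `i`. -/
noncomputable def numBetter (i : I) : ℕ := (P.filter fun j => key i (x i) < key j (x j)).card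

variable (P key x) in
/-- The potential of the Dürr–Høyer loop in round `r` with threshold `i`. -/
noncomputable def loopPotential (r : ℕ) (i : I) : ℝ :=
  if numBetter P key x i = 0 then 0 else
    searchPotential √((P.card : ℝ) / numBetter P key x i) r +
      36 * √(P.card : ℝ) * (thresholdPotential (numBetter P key x i) -
        1 / √(numBetter P key x i : ℝ))

omit [AddGroup A] in
theorem numBetter_lt {i : I} (hi : i ∈ P) : numBetter P key x i < P.card :=
  Finset.card_lt_card ⟨Finset.filter_subset _ _, fun h => by simpa using h hi⟩

/-- The difference is the mean of the potential over the ranks below `t`, the normalized cost that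
remains after a successful search. -/
theorem thresholdPotential_sub_nonneg {t : ℕ} (ht : t ≠ 0) :
    0 ≤ thresholdPotential t - 1 / √(t : ℝ) := by
  have h := sum_thresholdPotential t
  have h0 : 0 ≤ ∑ k ∈ Finset.range t, thresholdPotential k :=
    Finset.sum_nonneg fun k _ => thresholdPotential_nonneg k
  have ht' : (0 : ℝ) < t := by exact_mod_cast Nat.pos_of_ne_zero ht
  have h1 : (t : ℝ) * (thresholdPotential t - 1 / √(t : ℝ)) =
      t * thresholdPotential t - √(t : ℝ) := by
    rw [mul_sub, mul_one_div, Real.div_sqrt]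
  exact nonneg_of_mul_nonneg_right (by rw [h1, ← h]; exact h0) ht'

omit [AddGroup A] in
theorem loopPotential_nonneg (r : ℕ) (i : I) : 0 ≤ loopPotential P key x r i := by
  rw [loopPotential]
  split_ifs with h
  · exact le_rfl
  · have := thresholdPotential_sub_nonneg h
    have := searchPotential_nonneg √((P.card : ℝ) / numBetter P key x i) r
    positivity

omit [AddGroup A] in
-- The cost `36 √(N / t)` of a fresh search cancels the subtracted `1 / √t`; the threshold is not
-- better than itself, hence `t < N` and `T ≥ 1`.
theorem loopPotential_zero_le {i : I} (hi : i ∈ P) :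
    loopPotential P key x 0 i ≤ 36 * √(P.card : ℝ) * thresholdPotential (numBetter P key x i) := by
  have hn := thresholdPotential_nonneg (numBetter P key x i)
  rw [loopPotential]
  split_ifs with h
  · positivity
  · have ht : (0 : ℝ) < numBetter P key x i := by exact_mod_cast Nat.pos_of_ne_zero h
    have hT : 1 ≤ √((P.card : ℝ) / numBetter P key x i) := by
      rw [Real.one_le_sqrt, one_le_div ht]
      exact_mod_cast (numBetter_lt hi).le
    have := searchPotential_zero_le hT
    rw [Real.sqrt_div (Nat.cast_nonneg _)] at this ⊢
    have e : 36 * (√(P.card : ℝ) / √(numBetter P key x i : ℝ)) =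
      36 * √(P.card : ℝ) * (1 / √(numBetter P key x i : ℝ)) := by ring
    rw [mul_sub]
    linarith

omit [AddGroup A] in
-- After a success the threshold is uniform among the better items. Their potentials sum to at most
-- `t` times the part of the present potential reserved for later searches, which is why that part
-- has the form `thresholdPotential t - 1 / √t`.
theorem sum_better_loopPotential_le (i : I) :
    ∑ z ∈ P.filter (fun j => key i (x i) < key j (x j)), loopPotential P key x 0 z ≤
      numBetter P key x i * (36 * √(P.card : ℝ) *
        (thresholdPotential (numBetter P key x i) - 1 / √(numBetter P key x i : ℝ))) := by
  have h := sum_card_lt_le (fun j => key j (x j)) thresholdPotential_mono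
    (P.filter fun j => key i (x i) < key j (x j))
  rw [sum_thresholdPotential] at h
  calc _ ≤ ∑ z ∈ P.filter (fun j => key i (x i) < key j (x j)), 36 * √(P.card : ℝ) *
        thresholdPotential ((P.filter fun j => key i (x i) < key j (x j)).filter
          fun j => key z (x z) < key j (x j)).card := by
        refine Finset.sum_le_sum fun z hz => ?_
        rw [Finset.mem_filter] at hz
        refine (loopPotential_zero_le hz.1).trans_eq ?_
        rw [numBetter, Finset.filter_filter]
        congr 3
        refine Finset.filter_congr fun j _ => ⟨fun hj => ⟨hz.2.trans hj, hj⟩, fun hj => hj.2⟩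
    _ ≤ 36 * √(P.card : ℝ) * (numBetter P key x i * thresholdPotential (numBetter P key x i) -
        √(numBetter P key x i : ℝ)) := by
        rw [← Finset.mul_sum]
        gcongr
        exact h
    _ = _ := by
        rw [mul_left_comm, mul_sub (numBetter P key x i : ℝ), mul_one_div, Real.div_sqrt]

/-- The probability that the loop does not reach the maximum within `b` queries, multiplied by `b`,
is bounded by the potential. -/
theorem mul_failure_durrHoyerLoop_le (b : ℕ) : ∀ (r : ℕ) (i : I), i ∈ P →
    b * (durrHoyerLoop P hP key b r (i, x i)).failure x
      (fun y => ∀ j ∈ P, key j (x j) ≤ key y.1 y.2) ≤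
      ENNReal.ofReal (loopPotential P key x r i) := by
  classical
  induction b using Nat.strong_induction_on with
  | _ b ih =>
  intro r i hi
  -- Without a better item the threshold is already a maximum and is never made worse. Otherwise `0
  -- < t < N`, so that `sin θ` and `cos θ` are both nonzero.
  by_cases ht0 : numBetter P key x i = 0
  · have hmax : ∀ j ∈ P, key j (x j) ≤ key i (x i) := by
      intro j hj
      by_contra! hlt
      exact (Finset.card_ne_zero_of_mem (Finset.mem_filter.2 ⟨hj, hlt⟩)) ht0
    rw [QProg.failure_eq_zero, mul_zero]
    · exact zero_le
    · exact (surely_durrHoyerLoop b r i hi).mono fun y hy j hj => (hmax j hj).trans hy.2.2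
  set t := numBetter P key x i with ht
  set N := P.card with hN
  have hN0 : (0 : ℝ) < N := by exact_mod_cast hP.card_pos
  have ht' : (0 : ℝ) < t := by exact_mod_cast Nat.pos_of_ne_zero ht0
  have htN : (t : ℝ) < N := by exact_mod_cast numBetter_lt hi
  set θ := Real.arcsin √((t : ℝ) / N) with hθ
  have hq0 : 0 < √((t : ℝ) / N) := Real.sqrt_pos.2 (by positivity)
  have hq1 : √((t : ℝ) / N) < 1 := by
    rw [Real.sqrt_lt' one_pos, one_pow, div_lt_one hN0]; exact htN
  have hsin : Real.sin θ = √((t : ℝ) / N) := Real.sin_arcsin (by linarith) hq1.le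
  have hθ0 : 0 < θ := Real.arcsin_pos.2 hq0
  have hθ1 : θ < Real.pi / 2 := Real.arcsin_lt_pi_div_two.2 hq1
  have hcos : 0 < Real.cos θ := Real.cos_pos_of_mem_Ioo ⟨by linarith, hθ1⟩
  have hsq : (t : ℝ) = N * Real.sin θ ^ 2 := by
    rw [hsin, Real.sq_sqrt (by positivity)]; field_simp
  have hsq' : (N : ℝ) - t = N * Real.cos θ ^ 2 := by
    have := Real.sin_sq_add_cos_sq θ
    linear_combination (-1 : ℝ) * hsq - N * this
  set W := 36 * √(N : ℝ) * (thresholdPotential t - 1 / √(t : ℝ)) with hW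
  have hW0 : 0 ≤ W := mul_nonneg (mul_nonneg (by norm_num)
    (Real.sqrt_nonneg _)) (thresholdPotential_sub_nonneg ht0)
  set T := √((N : ℝ) / t) with hT
  have hTs : T * Real.sin θ = 1 := by
    rw [hsin, hT, ← Real.sqrt_mul (div_nonneg hN0.le ht'.le)]
    rw [div_mul_div_cancel₀ ht'.ne', div_self hN0.ne', Real.sqrt_one]
  have hpot : ∀ r, loopPotential P key x r i = searchPotential T r + W := fun r => by
    rw [loopPotential, if_neg ht0]
  set mark : I → A → Prop := fun j a => key i (x i) < key j a with hmark
  let hdec : ∀ j a, Decidable (mark j a) := fun j a => inferInstanceAs (Decidable (_ < _))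
  have hcard : (P.filter fun j => mark j (x j)).card = t := by
    rw [ht, numBetter]
  have hcard' : (((P.filter fun j => ¬ mark j (x j)).card : ℕ) : ℝ) = N - t := by
    have h1 := P.card_filter_add_card_filter_not (fun j => mark j (x j))
    have h2 : (t : ℝ) + (((P.filter fun j => ¬ mark j (x j)).card : ℕ) : ℝ) = N := by
      rw [← hcard]; exact_mod_cast h1
    linarith
  set M := ⌈searchBound N r⌉₊ with hM
  have hM0 : 0 < M := Nat.pos_of_ne_zero
    (Finset.nonempty_range_iff.1 (searchBound_range_nonempty hP.card_pos r))
  -- The bound for a fixed number `j` of iterations: the cost `2 j + 1`, the potential `W` of later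
  -- searches, and the potential of the next round in case of failure.
  have hround : ∀ j : ℕ, (b : ℝ≥0∞) * (if 2 * j + 1 ≤ b then
        (QProg.measureIndex (groverCircuit P hP mark j)).bind fun i' =>
        (QProg.ask i').bind fun a =>
        if key i (x i) < key i' a then durrHoyerLoop P hP key (b - (2 * j + 1)) 0 (i', a)
        else durrHoyerLoop P hP key (b - (2 * j + 1)) (r + 1) (i, x i)
      else QProg.ret (i, x i) : QProg I A (I × A)).failure x
        (fun y => ∀ j ∈ P, key j (x j) ≤ key y.1 y.2) ≤
      ENNReal.ofReal ((2 * j + 1) + W +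
        (1 - Real.sin ((2 * j + 1) * θ) ^ 2) * searchPotential T (r + 1)) := by
    intro j
    have hs1 : 0 ≤ 1 - Real.sin ((2 * j + 1) * θ) ^ 2 := by
      have := Real.sin_sq_le_one ((2 * j + 1) * θ); linarith
    have hf0 := searchPotential_nonneg T (r + 1)
    split_ifs with hj
    · have hamp := hasAmplitudes_groverCircuit (hP := hP) (mark := mark) (x := x) hcard
        (by rw [hsin]; exact hq0.ne') hcos.ne' hsq j
      set α := (2 * (j : ℝ) + 1) * θ with hα
      set p : I → ℝ := fun z => if mark z (x z) then Real.sin α ^ 2 / t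
        else Real.cos α ^ 2 / (N - t) with hp
      set Φ : I → ℝ := fun z => if mark z (x z) then loopPotential P key x 0 z
        else searchPotential T (r + 1) + W with hΦ
      have hNt : 0 < (N : ℝ) - t := by linarith
      have hp0 : ∀ z, 0 ≤ p z := fun z => by
        simp only [hp]; split_ifs <;> positivity
      have hΦ0 : ∀ z, 0 ≤ Φ z := fun z => by
        simp only [hΦ]
        split_ifs
        · exact loopPotential_nonneg _ _
        · exact add_nonneg hf0 hW0
      rw [QProg.failure, QProg.expect_bind, expect_measureIndex_groverCircuit hamp, Finset.mul_sum]
      calc _ ≤ ∑ z ∈ P, ENNReal.ofReal (p z * ((2 * j + 1) + Φ z)) := by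
            refine Finset.sum_le_sum fun z hz => ?_
            rw [mul_left_comm, ENNReal.ofReal_mul (hp0 z)]
            refine mul_le_mul (ENNReal.ofReal_le_ofReal (le_of_eq ?_)) ?_ zero_le zero_le
            · rw [Complex.norm_real, Real.norm_eq_abs, sq_abs]
              simp only [hp]
              split_ifs
              · rw [div_pow, mul_pow, Real.sq_sqrt hN0.le, ← hsq]
              · rw [div_pow, mul_pow, Real.sq_sqrt hN0.le, ← hsq']
            · rw [QProg.expect_bind, QProg.expect_ask]
              have hsplit : (b : ℝ≥0∞) =
                  ((b - (2 * j + 1) : ℕ) : ℝ≥0∞) + ENNReal.ofReal (2 * j + 1) := by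
                have : (2 * (j : ℝ) + 1) = ((2 * j + 1 : ℕ) : ℝ) := by push_cast; ring
                rw [this, ENNReal.ofReal_natCast]
                norm_cast
                omega
              -- The budget splits into the queries of this round, for which the failure probability
              -- is bounded by `1`, and the remaining budget, to which the induction hypothesis
              -- applies.
              have hstep : ∀ (Q : QProg I A (I × A)) (φ : ℝ), 0 ≤ φ →
                  ((b - (2 * j + 1) : ℕ) : ℝ≥0∞) * Q.failure x
                    (fun y => ∀ j ∈ P, key j (x j) ≤ key y.1 y.2) ≤ ENNReal.ofReal φ →
                  (b : ℝ≥0∞) * Q.failure x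
                    (fun y => ∀ j ∈ P, key j (x j) ≤ key y.1 y.2) ≤
                    ENNReal.ofReal ((2 * j + 1) + φ) := by
                intro Q φ hφ hQ
                rw [hsplit, add_mul, add_comm, ENNReal.ofReal_add (by positivity) hφ]
                refine add_le_add ?_ hQ
                exact mul_le_of_le_one_right zero_le (QProg.failure_le_one _ _)
              by_cases hk : mark z (x z)
              · rw [if_pos hk]
                refine hstep _ _ (hΦ0 z) ?_
                simp only [hΦ, if_pos hk]
                exact ih _ (by omega) 0 z hz
              · rw [if_neg hk]
                refine hstep _ _ (hΦ0 z) ?_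
                simp only [hΦ, if_neg hk]
                rw [← hpot]
                exact ih _ (by omega) (r + 1) i hi
        _ = ENNReal.ofReal (∑ z ∈ P, p z * ((2 * j + 1) + Φ z)) := by
            rw [ENNReal.ofReal_sum_of_nonneg]
            intro z _
            have := hp0 z
            have := hΦ0 z
            positivity
        _ ≤ _ := by
            refine ENNReal.ofReal_le_ofReal ?_
            rw [← Finset.sum_filter_add_sum_filter_not P (fun z => mark z (x z))]
            have e1 : ∑ z ∈ P.filter (fun z => mark z (x z)), p z * ((2 * j + 1) + Φ z) =
                Real.sin α ^ 2 * (2 * j + 1) + Real.sin α ^ 2 / t *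
                  ∑ z ∈ P.filter (fun z => mark z (x z)), loopPotential P key x 0 z := by
              rw [Finset.sum_congr (g := fun z => Real.sin α ^ 2 / t * (2 * j + 1) +
                Real.sin α ^ 2 / t * loopPotential P key x 0 z) rfl fun z hz => by
                  simp only [hp, hΦ, if_pos (Finset.mem_filter.1 hz).2]; ring]
              rw [Finset.sum_add_distrib, Finset.sum_const, ← Finset.mul_sum, hcard, nsmul_eq_mul]
              field_simp
            have e2 : ∑ z ∈ P.filter (fun z => ¬ mark z (x z)), p z * ((2 * j + 1) + Φ z) =
                Real.cos α ^ 2 * ((2 * j + 1) + (searchPotential T (r + 1) + W)) := by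
              rw [Finset.sum_congr (g := fun z => Real.cos α ^ 2 / (N - t) *
                ((2 * j + 1) + (searchPotential T (r + 1) + W))) rfl fun z hz => by
                  simp only [hp, hΦ, if_neg (Finset.mem_filter.1 hz).2]]
              rw [Finset.sum_const, nsmul_eq_mul, hcard']
              field_simp
            have e3 : Real.sin α ^ 2 / t *
                ∑ z ∈ P.filter (fun z => mark z (x z)), loopPotential P key x 0 z ≤
                Real.sin α ^ 2 / t * (t * W) := by
              refine mul_le_mul_of_nonneg_left ?_ (by positivity)
              exact sum_better_loopPotential_le i
            have e4 : Real.sin α ^ 2 / t * (t * W) = Real.sin α ^ 2 * W := by field_simp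
            have e5 : Real.cos α ^ 2 = 1 - Real.sin α ^ 2 := by
              have := Real.sin_sq_add_cos_sq α; linarith
            rw [e1, e2, e5]
            rw [e4] at e3
            nlinarith [e3]
    -- Interruption: the whole remaining budget is at most the cost `2 j + 1` of the round that was
    -- drawn.
    · refine (mul_le_of_le_one_right zero_le (QProg.failure_le_one _ _)).trans ?_
      rw [← ENNReal.ofReal_natCast]
      refine ENNReal.ofReal_le_ofReal ?_
      have h1 : (b : ℝ) ≤ 2 * j + 1 := by
        have : b ≤ 2 * j + 1 := by omega
        exact_mod_cast this
      have := mul_nonneg hs1 hf0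
      linarith
  rw [durrHoyerLoop_eq, QProg.failure, QProg.expect_bind, QProg.expect_draw, mul_left_comm,
    Finset.card_range, Finset.mul_sum]
  calc _ ≤ (M : ℝ≥0∞)⁻¹ * ∑ j ∈ Finset.range M, ENNReal.ofReal ((2 * j + 1) + W +
        (1 - Real.sin ((2 * j + 1) * θ) ^ 2) * searchPotential T (r + 1)) := by
        gcongr with j hj
        exact hround j
    _ = ENNReal.ofReal ((M : ℝ)⁻¹ * ∑ j ∈ Finset.range M, ((2 * j + 1) + W +
        (1 - Real.sin ((2 * j + 1) * θ) ^ 2) * searchPotential T (r + 1))) := by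
        rw [ENNReal.ofReal_mul (by positivity), ENNReal.ofReal_inv_of_pos (by exact_mod_cast hM0),
          ENNReal.ofReal_natCast, ENNReal.ofReal_sum_of_nonneg]
        intro j _
        have := Real.sin_sq_le_one ((2 * (j : ℝ) + 1) * θ)
        have hf := searchPotential_nonneg T (r + 1)
        have h1 : 0 ≤ 1 - Real.sin ((2 * (j : ℝ) + 1) * θ) ^ 2 := by linarith
        have h2 : (0 : ℝ) ≤ 2 * j + 1 := by positivity
        exact add_nonneg (add_nonneg h2 hW0) (mul_nonneg h1 hf)
    _ ≤ _ := by
        refine ENNReal.ofReal_le_ofReal ?_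
        have hMr : (0 : ℝ) < M := by exact_mod_cast hM0
        -- The mean of `2 j + 1` over `j < M` is `M`, the cost term in `searchPotential_step`.
        have hodd : ∀ m : ℕ, ∑ j ∈ Finset.range m, (2 * (j : ℝ) + 1) = (m : ℝ) * m := by
          intro m
          induction m with
          | zero => simp
          | succ m ihm => rw [Finset.sum_range_succ, ihm]; push_cast; ring
        set S := ∑ j ∈ Finset.range M, Real.sin ((2 * (j : ℝ) + 1) * θ) ^ 2 with hS
        have hsum : ∑ j ∈ Finset.range M, ((2 * (j : ℝ) + 1) + W +
            (1 - Real.sin ((2 * j + 1) * θ) ^ 2) * searchPotential T (r + 1)) =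
            (M : ℝ) * M + M * W + (M - S) * searchPotential T (r + 1) := by
          rw [Finset.sum_add_distrib, Finset.sum_add_distrib, hodd, Finset.sum_const (b := W),
            ← Finset.sum_mul, Finset.sum_sub_distrib]
          simp only [Finset.sum_const, Finset.card_range, nsmul_eq_mul, mul_one, ← hS]
        have hstep := searchPotential_step (T := T) (p := S / M) N r
          (div_nonneg (Finset.sum_nonneg fun j _ => sq_nonneg _) hMr.le) (fun hTr => by
            rw [div_le_div_iff₀ (by norm_num) hMr, one_mul]
            have h1 : 1 ≤ (M : ℝ) * Real.sin θ := by
              rw [← hTs]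
              -- The cap `√N` does no harm, because `T = √(N / t) ≤ √N`.
              have hTM : T ≤ M := by
                refine le_trans (le_min hTr ?_) (Nat.le_ceil _)
                refine Real.sqrt_le_sqrt (div_le_self hN0.le ?_)
                exact_mod_cast Nat.pos_of_ne_zero ht0
              have : 0 < Real.sin θ := by rw [hsin]; exact hq0
              gcongr
            have := quarter_le_sum_sin_sq_odd hθ0 hθ1 h1
            linarith)
        rw [hsum, hpot]
        have e : (M : ℝ)⁻¹ * ((M : ℝ) * M + M * W + (M - S) * searchPotential T (r + 1)) =
            M + (1 - S / M) * searchPotential T (r + 1) + W := by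
          field_simp
          ring
        rw [e]
        linarith

theorem durrHoyerMax_eq (P : Finset I) (hP : P.Nonempty) (key : I → A → κ) :
    durrHoyerMax P hP key = (QProg.draw P hP).bind fun i => (QProg.ask i).bind fun a =>
      durrHoyerLoop P hP key ⌈256 * √(P.card : ℝ)⌉₊ 0 (i, a) := rfl

/-- The Dürr–Høyer algorithm finds a maximum with probability at least `1 / 2`. -/
theorem failure_durrHoyerMax_le :
    (durrHoyerMax P hP key).failure x (fun y => ∀ j ∈ P, key j (x j) ≤ key y.1 y.2) ≤ 1 / 2 := by
  rw [durrHoyerMax_eq, QProg.failure, QProg.expect_bind]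
  have hdraw : (QProg.draw P hP : QProg I A I).Surely x (· ∈ P) := QProg.surely_draw P hP
  refine (QProg.expect_mono_of_surely (h := fun _ => 1 / 2) hdraw fun i hi => ?_).trans
    (QProg.expect_const _ _).le
  rw [QProg.expect_bind, QProg.expect_ask]
  have h := mul_failure_durrHoyerLoop_le (hP := hP) (key := key) (x := x)
    ⌈256 * √(P.card : ℝ)⌉₊ 0 i hi
  rw [QProg.failure] at h
  set F := (durrHoyerLoop P hP key ⌈256 * √(P.card : ℝ)⌉₊ 0 (i, x i)).expect x _
  have hs : 0 < √(P.card : ℝ) := Real.sqrt_pos.2 (by exact_mod_cast hP.card_pos)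
  have hB : ENNReal.ofReal (256 * √(P.card : ℝ)) ≤ (⌈256 * √(P.card : ℝ)⌉₊ : ℝ≥0∞) := by
    rw [← ENNReal.ofReal_natCast]
    exact ENNReal.ofReal_le_ofReal (Nat.le_ceil _)
  -- The potential of the first threshold is at most `36 √N * 2`, whatever item was drawn.
  have h2 : ENNReal.ofReal (256 * √(P.card : ℝ)) * F ≤ ENNReal.ofReal (72 * √(P.card : ℝ)) := by
    refine (mul_le_mul_left hB F).trans (h.trans (ENNReal.ofReal_le_ofReal ?_))
    have := loopPotential_zero_le (key := key) (x := x) hi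
    have := thresholdPotential_le_two (numBetter P key x i)
    nlinarith
  have h3 : F ≤ ENNReal.ofReal (72 * √(P.card : ℝ)) / ENNReal.ofReal (256 * √(P.card : ℝ)) := by
    rw [ENNReal.le_div_iff_mul_le (Or.inl (by simpa using hs)) (Or.inl ENNReal.ofReal_ne_top),
      mul_comm]
    exact h2
  refine h3.trans ?_
  rw [← ENNReal.ofReal_div_of_pos (by positivity), mul_div_mul_right _ _ hs.ne',
    show (1 / 2 : ℝ≥0∞) = ENNReal.ofReal (1 / 2) by
      rw [ENNReal.ofReal_div_of_pos (by norm_num)]; norm_num]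
  exact ENNReal.ofReal_le_ofReal (by norm_num)

theorem surely_durrHoyerMax :
    (durrHoyerMax P hP key).Surely x fun y => y.1 ∈ P ∧ y.2 = x y.1 := by
  rw [durrHoyerMax_eq]
  refine QProg.surely_bind (QProg.surely_draw P hP) fun i hi =>
    QProg.surely_bind (QProg.surely_ask i) fun a ha => ?_
  subst ha
  exact (surely_durrHoyerLoop _ 0 i hi).mono fun y hy => ⟨hy.1, hy.2.1⟩

theorem expectedQueries_durrHoyerMax_le :
    (durrHoyerMax P hP key).expectedQueries x ≤ ENNReal.ofReal (258 * √(P.card : ℝ)) := by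
  rw [durrHoyerMax_eq]
  refine (QProg.expectedQueries_bind_le (c := 1 + (⌈256 * √(P.card : ℝ)⌉₊ : ℝ≥0∞))
    (QProg.surely_true _) fun i _ => ?_).trans ?_
  · refine (QProg.expectedQueries_bind_le (QProg.surely_true _) fun a _ =>
      expectedQueries_durrHoyerLoop_le _ 0 (i, a)).trans_eq ?_
    rw [QProg.expectedQueries_ask]
  rw [QProg.expectedQueries_draw, zero_add]
  have h1 : (1 : ℝ) ≤ √(P.card : ℝ) := by
    rw [Real.one_le_sqrt]; exact_mod_cast hP.card_pos
  rw [← ENNReal.ofReal_natCast, ← ENNReal.ofReal_one, ← ENNReal.ofReal_add (by norm_num)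
    (Nat.cast_nonneg _)]
  refine ENNReal.ofReal_le_ofReal ?_
  have := Nat.ceil_lt_add_one (a := 256 * √(P.card : ℝ)) (by positivity)
  linarith

end DurrHoyer

/-! ## The first-one search -/

section FirstOne

variable {n : ℕ} [NeZero n] {deg : Degrees n} {visited : Finset (Fin n)} {v : Fin n} {start : ℕ}
  {x : Slot n → EdgeInfo n}

variable (deg visited v start x) in
/-- The entry `p` at or after `start` of the list of out-neighbours of `v` is fresh. -/
def FreshEntry (p : ℕ) : Prop :=
  start ≤ p ∧ p < deg.outDeg v ∧ IsFresh deg visited (x (.outSlot v p))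

variable (deg visited v start x) in
/-- `r` is the first fresh entry at or after `start`, if there is one. -/
def IsFirstFresh (r : Option ℕ) : Prop :=
  (r = none ∧ ∀ p, ¬ FreshEntry deg visited v start x p) ∨
    ∃ q, r = some q ∧ FreshEntry deg visited v start x q ∧
      ∀ p, FreshEntry deg visited v start x p → q ≤ p

variable (deg visited v start x) in
omit [NeZero n] in
theorem exists_isFirstFresh : ∃ r, IsFirstFresh deg visited v start x r := by
  classical
  by_cases h : ∃ p, FreshEntry deg visited v start x p
  · exact ⟨some (Nat.find h), Or.inr ⟨_, rfl, Nat.find_spec h, fun p hp => Nat.find_min' h hp⟩⟩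
  · exact ⟨none, Or.inl ⟨rfl, fun p hp => h ⟨p, hp⟩⟩⟩

omit [NeZero n] in
theorem mem_outBlock {len : ℕ} {i : Slot n} :
    i ∈ outBlock deg v start len ↔
      ∃ p, start ≤ p ∧ p < start + len ∧ p < deg.outDeg v ∧ i = .outSlot v p := by
  simp only [outBlock, Finset.mem_image, Finset.mem_Ico, lt_min_iff, and_assoc, eq_comm]

omit [NeZero n] in
theorem card_outBlock_le (len : ℕ) : (outBlock deg v start len).card ≤ len := by
  classical
  refine Finset.card_image_le.trans ?_
  rw [Nat.card_Ico]
  omega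

open Classical in
variable (deg visited) in
/-- The key by which the first fresh entry is found as a maximum. -/
noncomputable def firstKey (i : Slot n) (a : EdgeInfo n) : (WithTop ℕ)ᵒᵈ :=
  OrderDual.toDual (if IsFresh deg visited a then (i.pos : WithTop ℕ) else ⊤)

open Classical in
theorem firstOneStages_cons (e : ℕ) (es : List ℕ)
    (h : (outBlock deg v start (2 ^ e)).Nonempty) :
    firstOneStages deg visited v start (e :: es) =
      (durrHoyerMax (outBlock deg v start (2 ^ e)) h (firstKey deg visited)).bind fun y =>
        if IsFresh deg visited y.2 then QProg.ret (some y.1.pos)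
        else firstOneStages deg visited v start es := by
  rw [firstOneStages, dif_pos h]
  rfl

theorem firstOneStages_cons_of_empty (e : ℕ) (es : List ℕ)
    (h : ¬ (outBlock deg v start (2 ^ e)).Nonempty) :
    firstOneStages deg visited v start (e :: es) = QProg.ret none := by
  rw [firstOneStages, dif_neg h]
  rfl

theorem firstOneStages_nil : firstOneStages deg visited v start [] = QProg.ret none := rfl

/-- The error is one-sided: whatever is returned has been checked to be fresh. Correctness of the
minimum over the repetitions and the amortized cost analysis both rest on this. -/
theorem surely_firstOneStages (es : List ℕ) :
    (firstOneStages deg visited v start es).Surely x fun r =>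
      ∀ p, r = some p → FreshEntry deg visited v start x p := by
  classical
  induction es with
  | nil => exact QProg.surely_ret (by simp)
  | cons e es ih =>
    by_cases h : (outBlock deg v start (2 ^ e)).Nonempty
    · rw [firstOneStages_cons _ _ h]
      refine QProg.surely_bind surely_durrHoyerMax fun y hy => ?_
      obtain ⟨p, h1, -, h2, h3⟩ := mem_outBlock.1 hy.1
      split_ifs with hf
      · refine QProg.surely_ret ?_
        rintro q hq
        rw [h3, Option.some_inj] at hq
        rw [hy.2, h3] at hf
        obtain rfl : p = q := hq
        exact ⟨h1, h2, hf⟩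
      · exact ih
    · rw [firstOneStages_cons_of_empty _ _ h]
      exact QProg.surely_ret (by simp)

/-- In a block that contains the first fresh entry, the Dürr–Høyer search finds it with probability
at least `1 / 2`. -/
theorem failure_durrHoyerMax_firstKey_le {q len : ℕ}
    (hq : FreshEntry deg visited v start x q)
    (hmin : ∀ p, FreshEntry deg visited v start x p → q ≤ p) (hlen : q < start + len)
    (h : (outBlock deg v start len).Nonempty) :
    (durrHoyerMax (outBlock deg v start len) h (firstKey deg visited)).failure x
      (fun y => IsFresh deg visited y.2 ∧ y.1.pos = q) ≤ 1 / 2 := by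
  refine (QProg.failure_mono_of_surely surely_durrHoyerMax fun y hy hmax => ?_).trans
    failure_durrHoyerMax_le
  obtain ⟨p, h1, h2, h3, h4⟩ := mem_outBlock.1 hy.1
  have hle := hmax (.outSlot v q) (mem_outBlock.2 ⟨q, hq.1, hlen, hq.2.1, rfl⟩)
  rw [firstKey, firstKey, OrderDual.toDual_le_toDual, if_pos hq.2.2] at hle
  have hf : IsFresh deg visited y.2 := by
    by_contra hf
    rw [if_neg hf] at hle
    simp at hle
  rw [if_pos hf] at hle
  have hle' : y.1.pos ≤ q := by exact_mod_cast hle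
  refine ⟨hf, le_antisymm hle' ?_⟩
  rw [hy.2, h4] at hf
  rw [h4]
  exact hmin p ⟨h1, h3, hf⟩

/-- Blocks that end before `q` contain nothing fresh and surely pass the search on; only the first
block that reaches `q` can cause a failure. -/
theorem failure_firstOneStages_le {q : ℕ} (hq : FreshEntry deg visited v start x q)
    (hmin : ∀ p, FreshEntry deg visited v start x p → q ≤ p) (es : List ℕ)
    (hes : ∃ e ∈ es, q < start + 2 ^ e) :
    (firstOneStages deg visited v start es).failure x (· = some q) ≤ 1 / 2 := by
  classical
  induction es with
  | nil => simp at hes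
  | cons e es ih =>
    have h : (outBlock deg v start (2 ^ e)).Nonempty :=
      ⟨.outSlot v start, mem_outBlock.2
        ⟨start, le_rfl, by simp, hq.1.trans_lt hq.2.1, rfl⟩⟩
    rw [firstOneStages_cons _ _ h]
    by_cases hlt : q < start + 2 ^ e
    · refine (QProg.failure_bind_le (failure_durrHoyerMax_firstKey_le hq hmin hlt h)
        (d := 0) fun y hy => ?_).trans_eq (add_zero _)
      rw [if_pos hy.1, hy.2]
      rw [QProg.failure_ret (Q := (· = some q)) rfl]
    · have hnot : (durrHoyerMax (outBlock deg v start (2 ^ e)) h (firstKey deg visited)).Surely x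
          fun y => ¬ IsFresh deg visited y.2 := by
        refine surely_durrHoyerMax.mono fun y hy hf => ?_
        obtain ⟨p, h1, h2, h3, h4⟩ := mem_outBlock.1 hy.1
        rw [hy.2, h4] at hf
        have := hmin p ⟨h1, h3, hf⟩
        omega
      refine (QProg.failure_bind_le (QProg.failure_eq_zero hnot).le (d := 1 / 2)
        fun y hy => ?_).trans_eq (zero_add _)
      rw [if_neg hy]
      refine ih ?_
      obtain ⟨e', he', hlt'⟩ := hes
      rcases List.mem_cons.1 he' with rfl | he'
      · exact absurd hlt' hlt
      · exact ⟨e', he', hlt'⟩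

theorem option_merge_min_cases (a b : Option ℕ) :
    Option.merge min a b = a ∨ Option.merge min a b = b := by
  cases a <;> cases b <;> simp [Option.merge, le_total]

theorem surely_firstOneSearch :
    (firstOneSearch deg visited v start).Surely x fun r =>
      ∀ p, r = some p → FreshEntry deg visited v start x p := by
  refine QProg.surely_boost (surely_firstOneStages _) (by simp) (fun a b ha hb => ?_) _
  rcases option_merge_min_cases a b with h | h <;> rw [h] <;> assumption

/-- The first-one search is correct except with probability `2 ^ -numReps n`. -/
theorem failure_firstOneSearch_le {r : Option ℕ} (hr : IsFirstFresh deg visited v start x r) :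
    (firstOneSearch deg visited v start).failure x (· = r) ≤ (1 / 2) ^ numReps n := by
  rcases hr with ⟨rfl, hnone⟩ | ⟨q, rfl, hq, hmin⟩
  · refine (QProg.failure_eq_zero (surely_firstOneSearch.mono fun r hr => ?_)).trans_le zero_le
    cases r with
    | none => rfl
    | some p => exact absurd (hr p rfl) (hnone p)
  · have hP := surely_firstOneStages (deg := deg) (visited := visited) (v := v) (start := start)
      (x := x) (List.range (Nat.clog 2 (deg.outDeg v - start) + 1))
    refine (QProg.failure_boost_le hP (by simp) (fun a b ha hb => ?_) (fun b hb => ?_)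
      (fun b hb => ?_) _).trans ?_
    · rcases option_merge_min_cases a b with h | h <;> rw [h] <;> assumption
    · cases b with
      | none => rfl
      | some p => simpa [Option.merge] using hmin p (hb p rfl)
    · cases b with
      | none => rfl
      | some p => simpa [Option.merge] using hmin p (hb p rfl)
    · gcongr
      refine failure_firstOneStages_le hq hmin _
        ⟨Nat.clog 2 (deg.outDeg v - start), by simp, ?_⟩
      have := Nat.le_pow_clog one_lt_two (deg.outDeg v - start)
      have := hq.1
      have := hq.2.1
      omega

/-- The expected remaining cost of the first-one search, from the block of length `s ^ 2` on, if the
first fresh entry is at distance less than `R ^ 2`. -/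
noncomputable def stagePotential (R s : ℝ) : ℝ := if s < R then 10 * R - 5 / 2 * s else 4 * s

theorem stagePotential_nonneg {R s : ℝ} (hs : 0 ≤ s) : 0 ≤ stagePotential R s := by
  rw [stagePotential]; split_ifs <;> linarith

theorem stagePotential_one_le {R : ℝ} (hR : 1 ≤ R) : stagePotential R 1 ≤ 10 * R := by
  rw [stagePotential]; split_ifs <;> linarith

/-- Doubling the block multiplies `s` by `√2`, which lies between `7 / 5` and `3 / 2`. Below `R`,
the drop `5 / 2 * (2 / 5) s` pays for the stage; when `R` is passed, `s + 4 * (3 / 2) s` is still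
covered. -/
theorem stagePotential_step_of_lt {R s s' : ℝ} (h1 : 7 / 5 * s ≤ s') (h2 : s' ≤ 3 / 2 * s)
    (hs : s < R) : s + stagePotential R s' ≤ stagePotential R s := by
  rw [stagePotential, stagePotential, if_pos hs]; split_ifs <;> linarith

/-- Once the block contains the first fresh entry, the search goes on with probability at most `1 /
2`, and `s + (1 / 2) * 4 * (3 / 2) s = 4 s`. -/
theorem stagePotential_step_of_le {R s s' : ℝ} (hs0 : 0 ≤ s) (h1 : 7 / 5 * s ≤ s')
    (h2 : s' ≤ 3 / 2 * s) (hs : R ≤ s) : s + 1 / 2 * stagePotential R s' ≤ stagePotential R s := by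
  rw [stagePotential, stagePotential, if_neg (by linarith), if_neg (by linarith)]; linarith

/-- The costs grow geometrically up to block length `D`. Beyond it, either each further stage occurs
with probability at most `1 / 2`, or `D` is the length of the rest of the list and no stage is left.
-/
theorem expectedQueries_firstOneStages_le {D : ℕ} (k : ℕ) : ∀ e : ℕ,
    ((∃ q, FreshEntry deg visited v start x q ∧
        (∀ p, FreshEntry deg visited v start x p → q ≤ p) ∧ q + 1 = start + D) ∨
      (D = deg.outDeg v - start ∧ e + k ≤ Nat.clog 2 (deg.outDeg v - start) + 1)) →
    (firstOneStages deg visited v start (List.range' e k)).expectedQueries x ≤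
      ENNReal.ofReal (258 * stagePotential √(D : ℝ) √((2 ^ e : ℕ) : ℝ)) := by
  classical
  induction k with
  | zero =>
    intro e _
    rw [List.range'_zero, firstOneStages_nil, QProg.expectedQueries_ret]
    exact zero_le
  | succ k ih =>
    intro e hD
    rw [List.range'_succ]
    by_cases h : (outBlock deg v start (2 ^ e)).Nonempty
    swap
    · rw [firstOneStages_cons_of_empty _ _ h, QProg.expectedQueries_ret]
      exact zero_le
    have ih' := ih (e + 1) (hD.imp_right fun h => ⟨h.1, by omega⟩)
    rw [firstOneStages_cons _ _ h, QProg.expectedQueries_bind]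
    set s := √((2 ^ e : ℕ) : ℝ) with hs
    set s' := √((2 ^ (e + 1) : ℕ) : ℝ) with hs'
    set c := (firstOneStages deg visited v start (List.range' (e + 1) k)).expectedQueries x with hc
    have hs0 : 0 ≤ s := Real.sqrt_nonneg _
    have hss : s' = √2 * s := by
      rw [hs', hs, ← Real.sqrt_mul (by norm_num)]; congr 1; push_cast; ring
    have h1 : 7 / 5 * s ≤ s' := by
      rw [hss]; gcongr; exact Real.le_sqrt_of_sq_le (by norm_num)
    have h2 : s' ≤ 3 / 2 * s := by
      rw [hss]; gcongr; exact Real.sqrt_le_iff.2 (by norm_num)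
    have hn' : 0 ≤ stagePotential √(D : ℝ) s' := stagePotential_nonneg (by linarith)
    have hcost : (durrHoyerMax (outBlock deg v start (2 ^ e)) h
        (firstKey deg visited)).expectedQueries x ≤ ENNReal.ofReal (258 * s) := by
      refine expectedQueries_durrHoyerMax_le.trans (ENNReal.ofReal_le_ofReal ?_)
      refine mul_le_mul_of_nonneg_left (Real.sqrt_le_sqrt ?_) (by norm_num)
      exact_mod_cast card_outBlock_le (2 ^ e)
    have hrest : ∀ y : Slot n × EdgeInfo n, (if IsFresh deg visited y.2 then
        (QProg.ret (some y.1.pos) : GraphProg n (Option ℕ)) else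
        firstOneStages deg visited v start (List.range' (e + 1) k)).expectedQueries x ≤ c := by
      intro y
      split_ifs
      · rw [QProg.expectedQueries_ret]; exact zero_le
      · exact le_rfl
    by_cases hlt : s < √(D : ℝ)
    · refine (add_le_add hcost ((QProg.expect_le_const hrest).trans ih')).trans ?_
      rw [← ENNReal.ofReal_add (by positivity) (by positivity)]
      refine ENNReal.ofReal_le_ofReal ?_
      have := stagePotential_step_of_lt h1 h2 hlt
      linarith
    · have hDe : D ≤ 2 ^ e := by
        rw [not_lt, hs] at hlt
        exact_mod_cast (Real.sqrt_le_sqrt_iff (by positivity)).1 hlt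
      rcases hD with ⟨q, hq, hmin, hqD⟩ | ⟨hDL, hk⟩
      · have hfail := failure_durrHoyerMax_firstKey_le hq hmin (len := 2 ^ e) (by omega) h
        refine (add_le_add hcost (d := ENNReal.ofReal (1 / 2 * (258 * stagePotential √(D : ℝ) s')))
          ?_).trans ?_
        -- The next stage is entered only after an answer that is not fresh, which is a failure of
        -- this block.
        · calc _ ≤ (durrHoyerMax (outBlock deg v start (2 ^ e)) h (firstKey deg visited)).expect x
                fun y => c * (if IsFresh deg visited y.2 ∧ y.1.pos = q then 0 else 1) := by
                refine QProg.expect_mono fun y => ?_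
                by_cases hy : IsFresh deg visited y.2
                · rw [if_pos hy, QProg.expectedQueries_ret]; exact zero_le
                · rw [if_neg hy, if_neg (fun h => hy h.1), mul_one]
            _ ≤ c * (1 / 2) := by
                rw [QProg.expect_const_mul, ← QProg.failure_eq_expect]
                gcongr
            _ ≤ _ := by
                rw [mul_comm, ENNReal.ofReal_mul (by norm_num)]
                refine mul_le_mul (le_of_eq ?_) ih' zero_le zero_le
                rw [ENNReal.ofReal_div_of_pos (by norm_num)]; norm_num
        · rw [← ENNReal.ofReal_add (by positivity) (by positivity)]
          refine ENNReal.ofReal_le_ofReal ?_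
          have := stagePotential_step_of_le hs0 h1 h2 (not_lt.1 hlt)
          linarith
      -- The block covers the rest of the list, so this was the last stage.
      · have hck : Nat.clog 2 (deg.outDeg v - start) ≤ e :=
          (Nat.clog_le_iff_le_pow one_lt_two).2 (hDL ▸ hDe)
        obtain rfl : k = 0 := by omega
        have hc0 : c = 0 := by
          rw [hc, List.range'_zero, firstOneStages_nil, QProg.expectedQueries_ret]
        refine (add_le_add hcost ((QProg.expect_le_const hrest).trans hc0.le)).trans ?_
        rw [add_zero]
        refine ENNReal.ofReal_le_ofReal ?_
        have := stagePotential_step_of_le hs0 h1 h2 (not_lt.1 hlt)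
        linarith

/-- The expected cost of the first-one search is governed by the number `D` of entries up to the one
that is found. -/
theorem exists_expectedQueries_firstOneSearch_le :
    ∃ D : ℕ, (firstOneSearch deg visited v start).expectedQueries x ≤
        ENNReal.ofReal (2580 * numReps n * √(D : ℝ)) ∧
      D ≤ deg.outDeg v - start ∧
      ∀ p, FreshEntry deg visited v start x p → D ≤ p + 1 - start := by
  have key : ∀ D : ℕ, 0 < D → ((∃ q, FreshEntry deg visited v start x q ∧
        (∀ p, FreshEntry deg visited v start x p → q ≤ p) ∧ q + 1 = start + D) ∨
      D = deg.outDeg v - start) →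
      (firstOneSearch deg visited v start).expectedQueries x ≤
        ENNReal.ofReal (2580 * numReps n * √(D : ℝ)) := by
    intro D hD0 hD
    have h := expectedQueries_firstOneStages_le (D := D) (x := x) (visited := visited)
      (Nat.clog 2 (deg.outDeg v - start) + 1) 0 (hD.imp_right fun h => ⟨h, by omega⟩)
    rw [firstOneSearch, QProg.expectedQueries_boost, List.range_eq_range', mul_comm (2580 : ℝ),
      mul_assoc, ENNReal.ofReal_mul (Nat.cast_nonneg _), ENNReal.ofReal_natCast]
    gcongr
    refine h.trans (ENNReal.ofReal_le_ofReal ?_)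
    have := stagePotential_one_le (R := √(D : ℝ)) (by
      rw [Real.one_le_sqrt]; exact_mod_cast hD0)
    simp only [pow_zero, Nat.cast_one, Real.sqrt_one]
    linarith
  obtain ⟨r, ⟨-, hnone⟩ | ⟨q, -, hq, hmin⟩⟩ := exists_isFirstFresh deg visited v start x
  · rcases Nat.eq_zero_or_pos (deg.outDeg v - start) with h0 | h0
    -- At the end of the list the first block is empty and nothing is queried, as the bound with `D
    -- = 0` requires.
    · refine ⟨0, ?_, zero_le, fun p hp => absurd hp (hnone p)⟩
      rw [firstOneSearch, QProg.expectedQueries_boost, List.range_succ_eq_map,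
        firstOneStages_cons_of_empty, QProg.expectedQueries_ret, mul_zero]
      · exact zero_le
      · rintro ⟨i, hi⟩
        obtain ⟨p, h1, -, h2, -⟩ := mem_outBlock.1 hi
        omega
    · exact ⟨_, key _ h0 (Or.inr rfl), le_rfl, fun p hp => absurd hp (hnone p)⟩
  · have h1 := hq.1
    have h2 := hq.2.1
    refine ⟨q + 1 - start, key _ (by omega) (Or.inl ⟨q, hq, hmin, by omega⟩), by omega,
      fun p hp => ?_⟩
    have := hmin p hp
    omega

end FirstOne

/-! ## The cost of the topological sort -/

namespace QProg

variable {I A α β : Type} [AddGroup A] {x : I → A}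

variable (x) in
/-- The expected number of queries together with the expectation of a potential of the result. -/
noncomputable def amortizedCost (P : QProg I A α) (Φ : α → ℝ≥0∞) : ℝ≥0∞ :=
  P.expectedQueries x + P.expect x Φ

theorem amortizedCost_bind (P : QProg I A α) (k : α → QProg I A β) (Φ : β → ℝ≥0∞) :
    (P.bind k).amortizedCost x Φ = P.amortizedCost x fun a => (k a).amortizedCost x Φ := by
  simp only [amortizedCost, expectedQueries_bind, expect_bind, expect_add, add_assoc]

theorem amortizedCost_ret (a : α) (Φ : α → ℝ≥0∞) :
    (ret a : QProg I A α).amortizedCost x Φ = Φ a := by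
  simp only [amortizedCost, expectedQueries_ret, expect_ret, zero_add]

theorem amortizedCost_ask (i : I) (Φ : A → ℝ≥0∞) :
    (ask i : QProg I A A).amortizedCost x Φ = 1 + Φ (x i) := by
  simp only [amortizedCost, expectedQueries_ask, expect_ask]

theorem amortizedCost_mono_of_surely {P : QProg I A α} {Q : α → Prop} (hP : P.Surely x Q)
    {Φ Ψ : α → ℝ≥0∞} (H : ∀ a, Q a → Φ a ≤ Ψ a) : P.amortizedCost x Φ ≤ P.amortizedCost x Ψ :=
  add_le_add le_rfl (expect_mono_of_surely hP H)

theorem amortizedCost_add_const (P : QProg I A α) (Φ : α → ℝ≥0∞) (c : ℝ≥0∞) :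
    (P.amortizedCost x fun a => Φ a + c) = P.amortizedCost x Φ + c := by
  simp only [amortizedCost, expect_add, expect_const, add_assoc]

/-- The expected cost of `P` is a constant, so it may be charged to each outcome separately. -/
theorem amortizedCost_le {P : QProg I A α} {Q : α → Prop} (hP : P.Surely x Q)
    {Φ : α → ℝ≥0∞} {c : ℝ≥0∞} (H : ∀ a, Q a → P.expectedQueries x + Φ a ≤ c) :
    P.amortizedCost x Φ ≤ c := by
  rw [amortizedCost, ← expect_const P (P.expectedQueries x), ← expect_add]
  exact (expect_mono_of_surely hP H).trans (expect_const P c).le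

end QProg

section TopSort

variable {n : ℕ} [NeZero n] {deg : Degrees n} {x : Slot n → EdgeInfo n}

theorem topSortScan_zero (dfs : Fin n → SortState n → GraphProg n (SortState n)) (v : Fin n)
    (start : ℕ) (st : SortState n) : topSortScan deg dfs v 0 start st = QProg.ret st := rfl

theorem topSortScan_succ (dfs : Fin n → SortState n → GraphProg n (SortState n)) (v : Fin n)
    (g start : ℕ) (st : SortState n) :
    topSortScan deg dfs v (g + 1) start st =
      (firstOneSearch deg st.visited v start).bind fun r =>
        r.elim (QProg.ret st) fun z => (QProg.ask (Slot.outSlot v z)).bind fun a =>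
          (dfs a.1 st).bind fun st' => topSortScan deg dfs v g (z + 1) st' := by
  rw [topSortScan]
  change QProg.bind _ _ = _
  congr 1
  funext r
  cases r <;> rfl

theorem topSortDFS_succ {v : Fin n} (hv : 0 < deg.outDeg v) (f : ℕ) (st : SortState n) :
    topSortDFS deg (f + 1) v st =
      (topSortScan deg (topSortDFS deg f) v (deg.outDeg v + 1) 0
        ⟨insert v st.visited, st.order⟩).bind fun st' =>
          QProg.ret ⟨st'.visited, v :: st'.order⟩ := by
  rw [topSortDFS, if_pos hv]
  rfl

theorem topSortDFS_succ_of_sink {v : Fin n} (hv : ¬ 0 < deg.outDeg v) (f : ℕ) (st : SortState n) :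
    topSortDFS deg (f + 1) v st = QProg.ret ⟨insert v st.visited, st.order⟩ := by
  rw [topSortDFS, if_neg hv]
  rfl

theorem surely_topSortScan_visited {dfs : Fin n → SortState n → GraphProg n (SortState n)}
    (hdfs : ∀ v st, (dfs v st).Surely x fun st' => st.visited ⊆ st'.visited) (v : Fin n) (g : ℕ) :
    ∀ (start : ℕ) (st : SortState n),
      (topSortScan deg dfs v g start st).Surely x fun st' => st.visited ⊆ st'.visited := by
  induction g with
  | zero => exact fun start st => QProg.surely_ret subset_rfl
  | succ g ih =>
    intro start st
    rw [topSortScan_succ]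
    refine QProg.surely_bind (QProg.surely_true _) fun r _ => ?_
    cases r with
    | none => exact QProg.surely_ret subset_rfl
    | some z =>
      refine QProg.surely_bind (QProg.surely_true _) fun a _ => ?_
      refine QProg.surely_bind (hdfs a.1 st) fun st' hst' => ?_
      exact (ih (z + 1) st').mono fun st'' h => hst'.trans h

theorem surely_topSortDFS_visited (f : ℕ) : ∀ (v : Fin n) (st : SortState n),
    (topSortDFS deg f v st).Surely x fun st' => st.visited ⊆ st'.visited := by
  induction f with
  | zero => exact fun v st => QProg.surely_ret subset_rfl
  | succ f ih =>
    intro v st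
    by_cases hv : 0 < deg.outDeg v
    · rw [topSortDFS_succ hv]
      refine QProg.surely_bind (surely_topSortScan_visited ih _ _ _ _) fun st' hst' => ?_
      exact QProg.surely_ret ((Finset.subset_insert _ _).trans hst')
    · rw [topSortDFS_succ_of_sink hv]
      exact QProg.surely_ret (Finset.subset_insert _ _)

/-- The potential of the depth-first search: the weights `w` of the unvisited vertices and the
weights `ρ` of the ordered ones. -/
noncomputable def sortPotential (w ρ : Fin n → ℝ≥0∞) (st : SortState n) : ℝ≥0∞ :=
  ∑ u ∈ Finset.univ \ st.visited, w u + (st.order.map ρ).sum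

omit [NeZero n] in
theorem sortPotential_insert (w ρ : Fin n → ℝ≥0∞) {v : Fin n} {st : SortState n}
    (hv : v ∉ st.visited) :
    w v + sortPotential w ρ ⟨insert v st.visited, st.order⟩ = sortPotential w ρ st := by
  rw [sortPotential, sortPotential, ← add_assoc]
  congr 1
  rw [← Finset.sum_insert (by simp)]
  refine Finset.sum_congr ?_ fun _ _ => rfl
  ext u
  by_cases hu : u = v
  · simp [hu, hv]
  · simp [hu]

variable {w ρ : Fin n → ℝ≥0∞} {a b : ℝ≥0∞}

/-- The cost is charged to the stretch of the list that is skipped, for every possible outcome and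
not only the correct one. The `+ 1` pays for the classical query of the entry found. -/
theorem expectedQueries_firstOneSearch_le_linear
    (hab : ∀ m : ℕ, 1 ≤ m → ENNReal.ofReal (2580 * numReps n * √(m : ℝ)) + 1 ≤ a * m + b)
    (visited : Finset (Fin n)) (v : Fin n) (start : ℕ) :
    (firstOneSearch deg visited v start).expectedQueries x ≤
        a * (deg.outDeg v - start : ℕ) + b ∧
      ∀ p, FreshEntry deg visited v start x p →
        (firstOneSearch deg visited v start).expectedQueries x + 1 ≤
          a * (p + 1 - start : ℕ) + b := by
  obtain ⟨m, hm, hmL, hmp⟩ := exists_expectedQueries_firstOneSearch_le (deg := deg)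
    (visited := visited) (v := v) (start := start) (x := x)
  constructor
  · refine hm.trans ?_
    rcases Nat.eq_zero_or_pos m with rfl | h
    · simp
    · refine (le_self_add.trans (hab m h)).trans ?_
      gcongr
  · intro p hp
    have h1 := hp.1
    refine le_trans ?_ (hab (p + 1 - start) (by omega))
    gcongr
    refine hm.trans (ENNReal.ofReal_le_ofReal ?_)
    gcongr
    exact hmp p hp

/-- The stretches skipped by consecutive searches are disjoint and use up `a` times the rest of the
list. The `b` of a successful search is left over by the recursive call on the vertex it found, and
the `b` on the right pays for the search that ends the scan. -/
theorem amortizedCost_topSortScan_le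
    (hab : ∀ m : ℕ, 1 ≤ m → ENNReal.ofReal (2580 * numReps n * √(m : ℝ)) + 1 ≤ a * m + b)
    {f : ℕ} (hdfs : ∀ (v : Fin n) (st : SortState n), v ∉ st.visited → 0 < deg.outDeg v →
      n ≤ f + st.visited.card →
      (topSortDFS deg f v st).amortizedCost x (sortPotential w ρ) + b ≤ sortPotential w ρ st)
    (v : Fin n) (g : ℕ) : ∀ (start : ℕ) (st : SortState n), n ≤ f + st.visited.card →
      (topSortScan deg (topSortDFS deg f) v g start st).amortizedCost x (sortPotential w ρ) ≤
        sortPotential w ρ st + (a * (deg.outDeg v - start : ℕ) + b) := by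
  induction g with
  | zero =>
    intro start st _
    rw [topSortScan_zero, QProg.amortizedCost_ret]
    exact le_self_add
  | succ g ih =>
    intro start st hst
    obtain ⟨h1, h2⟩ := expectedQueries_firstOneSearch_le_linear (deg := deg) (x := x) hab
      st.visited v start
    rw [topSortScan_succ, QProg.amortizedCost_bind]
    refine QProg.amortizedCost_le surely_firstOneSearch fun r hr => ?_
    cases r with
    | none =>
      simp only [Option.elim, QProg.amortizedCost_ret]
      rw [add_comm]
      gcongr
    | some z =>
      have hz := hr z rfl
      have hz1 := hz.1
      have hz2 := hz.2.1
      simp only [Option.elim]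
      rw [QProg.amortizedCost_bind, QProg.amortizedCost_ask, QProg.amortizedCost_bind, ← add_assoc]
      set c := (x (Slot.outSlot v z)).1
      have h3 := hdfs c st hz.2.2.1 hz.2.2.2 hst
      have h4 : (topSortDFS deg f c st).amortizedCost x (fun st' =>
          (topSortScan deg (topSortDFS deg f) v g (z + 1) st').amortizedCost x
            (sortPotential w ρ)) ≤ sortPotential w ρ st + a * (deg.outDeg v - (z + 1) : ℕ) := by
        calc _ ≤ (topSortDFS deg f c st).amortizedCost x fun st' =>
              sortPotential w ρ st' + (a * (deg.outDeg v - (z + 1) : ℕ) + b) := by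
              refine QProg.amortizedCost_mono_of_surely (surely_topSortDFS_visited f c st)
                fun st' hst' => ih _ _ (hst.trans ?_)
              gcongr
          _ = (topSortDFS deg f c st).amortizedCost x (sortPotential w ρ) + b +
                a * (deg.outDeg v - (z + 1) : ℕ) := by
              rw [QProg.amortizedCost_add_const]; ring
          _ ≤ _ := by gcongr
      refine (add_le_add (h2 z hz) h4).trans_eq ?_
      have h5 : ((deg.outDeg v - start : ℕ) : ℝ≥0∞) =
          (z + 1 - start : ℕ) + (deg.outDeg v - (z + 1) : ℕ) := by
        norm_cast; omega
      rw [h5]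
      ring

/-- Visiting `v` releases `w v`, which pays for its list, for the search that found it, for the last
search of its scan, and for its weight `ρ v` in the order. As every call visits a new vertex, `n ≤ f
+ st.visited.card` ensures that the depth bound is never reached. -/
theorem amortizedCost_topSortDFS_le
    (hab : ∀ m : ℕ, 1 ≤ m → ENNReal.ofReal (2580 * numReps n * √(m : ℝ)) + 1 ≤ a * m + b)
    (hw : ∀ u, 0 < deg.outDeg u → a * deg.outDeg u + 2 * b + ρ u ≤ w u) (f : ℕ) :
    ∀ (v : Fin n) (st : SortState n), v ∉ st.visited → 0 < deg.outDeg v →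
      n ≤ f + st.visited.card →
      (topSortDFS deg f v st).amortizedCost x (sortPotential w ρ) + b ≤ sortPotential w ρ st := by
  induction f with
  | zero =>
    intro v st hv _ hn
    have := Finset.card_lt_univ_of_notMem hv
    rw [Fintype.card_fin] at this
    omega
  | succ f ih =>
    intro v st hv hd hn
    rw [topSortDFS_succ hd, QProg.amortizedCost_bind, ← sortPotential_insert w ρ hv]
    have h := amortizedCost_topSortScan_le hab ih v (deg.outDeg v + 1) 0
      ⟨insert v st.visited, st.order⟩ (by
        rw [Finset.card_insert_of_notMem hv]; omega)
    have e : ∀ st' : SortState n, (QProg.ret ⟨st'.visited, v :: st'.order⟩ :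
        GraphProg n (SortState n)).amortizedCost x (sortPotential w ρ) =
        sortPotential w ρ st' + ρ v := by
      intro st'
      rw [QProg.amortizedCost_ret, sortPotential, sortPotential, List.map_cons, List.sum_cons]
      ring
    simp only [e, QProg.amortizedCost_add_const]
    calc _ ≤ sortPotential w ρ ⟨insert v st.visited, st.order⟩ +
            (a * (deg.outDeg v - 0 : ℕ) + b) + ρ v + b := by gcongr
      _ = (a * deg.outDeg v + 2 * b + ρ v) + sortPotential w ρ ⟨insert v st.visited, st.order⟩ := by
          rw [Nat.sub_zero]; ring
      _ ≤ _ := by gcongr; exact hw v hd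

theorem amortizedCost_topSortFrom_le
    (hab : ∀ m : ℕ, 1 ≤ m → ENNReal.ofReal (2580 * numReps n * √(m : ℝ)) + 1 ≤ a * m + b)
    (hw : ∀ u, 0 < deg.outDeg u → a * deg.outDeg u + 2 * b + ρ u ≤ w u) (l : List (Fin n)) :
    ∀ st : SortState n,
      (topSortFrom deg l st).amortizedCost x (sortPotential w ρ) ≤ sortPotential w ρ st := by
  induction l with
  | nil => exact fun st => (QProg.amortizedCost_ret _ _).le
  | cons v l ih =>
    intro st
    rw [topSortFrom]
    split_ifs with hv
    · exact ih st
    · change QProg.amortizedCost x (QProg.bind _ _) _ ≤ _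
      rw [QProg.amortizedCost_bind]
      refine (QProg.amortizedCost_mono_of_surely (QProg.surely_true _) fun st' _ => ih st').trans ?_
      -- A source may be a sink as well; its search only marks it and makes no queries.
      by_cases hd : 0 < deg.outDeg v
      · exact le_self_add.trans (amortizedCost_topSortDFS_le hab hw n v st hv hd le_self_add)
      · obtain ⟨k, rfl⟩ := Nat.exists_eq_succ_of_ne_zero (NeZero.ne n)
        rw [topSortDFS_succ_of_sink hd, QProg.amortizedCost_ret, ← sortPotential_insert w ρ hv]
        exact le_add_self

omit [NeZero n] in
theorem sum_map_filter_finRange_le (p : Fin n → Prop) [DecidablePred p] (ρ : Fin n → ℝ≥0∞) :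
    (((List.finRange n).filter p).map ρ).sum ≤ ∑ u, ρ u := by
  rw [← List.sum_toFinset _ ((List.nodup_finRange n).filter _)]
  exact Finset.sum_le_univ_sum_of_nonneg fun _ => zero_le

theorem topSort_eq : topSort deg =
    (topSortFrom deg ((List.finRange n).filter fun v => deg.inDeg v = 0) ⟨∅, []⟩).bind fun st =>
      QProg.ret (st.order ++ (List.finRange n).filter fun v => deg.outDeg v = 0) := rfl

/-- The expected cost of the topological sort, together with a weight `ρ` for each vertex of the
resulting order. -/
theorem amortizedCost_topSort_le
    (hab : ∀ m : ℕ, 1 ≤ m → ENNReal.ofReal (2580 * numReps n * √(m : ℝ)) + 1 ≤ a * m + b)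
    (hw : ∀ u, 0 < deg.outDeg u → a * deg.outDeg u + 2 * b + ρ u ≤ w u) :
    (topSort deg).amortizedCost x (fun l => (l.map ρ).sum) ≤ ∑ u, w u + ∑ u, ρ u := by
  rw [topSort_eq, QProg.amortizedCost_bind]
  calc _ ≤ (topSortFrom deg ((List.finRange n).filter fun v => deg.inDeg v = 0)
        ⟨∅, []⟩).amortizedCost x fun st => sortPotential w ρ st + ∑ u, ρ u := by
        refine QProg.amortizedCost_mono_of_surely (QProg.surely_true _) fun st _ => ?_
        rw [QProg.amortizedCost_ret, List.map_append, List.sum_append, sortPotential]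
        exact add_le_add le_add_self (sum_map_filter_finRange_le _ ρ)
    _ ≤ _ := by
        rw [QProg.amortizedCost_add_const]
        gcongr
        refine (amortizedCost_topSortFrom_le hab hw _ _).trans_eq ?_
        simp [sortPotential]

end TopSort

/-! ## The correctness of the topological sort -/

section Correctness

variable {n : ℕ} [NeZero n] {G : WeightedDAG n} (D : G.AdjLists)

namespace WeightedDAG.AdjLists

omit [NeZero n] in
theorem outDeg_pos_iff {v : Fin n} : 0 < D.degrees.outDeg v ↔ ∃ w, G.Adj v w := by
  change 0 < (D.outList v).length ↔ _
  rw [List.length_pos_iff_exists_mem]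
  simp only [D.mem_outList]

omit [NeZero n] in
theorem inDeg_eq_zero_iff {v : Fin n} : D.degrees.inDeg v = 0 ↔ ∀ u, ¬ G.Adj u v := by
  change (D.inList v).length = 0 ↔ _
  rw [List.length_eq_zero_iff, List.eq_nil_iff_forall_not_mem]
  simp only [D.mem_inList]

theorem oracle_outSlot {v : Fin n} {p : ℕ} (hp : p < D.degrees.outDeg v) :
    ∃ u, D.oracle (.outSlot v p) = (u, G.weight v u) ∧ G.Adj v u ∧ (D.outList v)[p]? = some u := by
  have hp' : p < (D.outList v).length := hp
  refine ⟨(D.outList v)[p], ?_, (D.mem_outList _ _).1 (List.getElem_mem hp'),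
    List.getElem?_eq_getElem hp'⟩
  simp [oracle, List.getElem?_eq_getElem hp']

theorem exists_outSlot {v w : Fin n} (h : G.Adj v w) :
    ∃ p < D.degrees.outDeg v, D.oracle (.outSlot v p) = (w, G.weight v w) := by
  obtain ⟨p, hp, hw⟩ := List.getElem_of_mem ((D.mem_outList v w).2 h)
  exact ⟨p, hp, by simp [oracle, List.getElem?_eq_getElem hp, hw]⟩

/-- In the list, the out-neighbours of each vertex that are not sinks come after it. -/
def IsClosedOrder : List (Fin n) → Prop
  | [] => True
  | v :: l => (∀ w, G.Adj v w → 0 < D.degrees.outDeg w → w ∈ l) ∧ IsClosedOrder l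

/-- The invariants of the depth-first search. -/
structure SortInv (st : SortState n) : Prop where
  nodup : st.order.Nodup
  visited : ∀ u ∈ st.order, u ∈ st.visited
  outDeg_pos : ∀ u ∈ st.order, 0 < D.degrees.outDeg u
  closed : D.IsClosedOrder st.order

/-- The vertices whose search is not yet finished. -/
def Grey (st : SortState n) (u : Fin n) : Prop :=
  0 < D.degrees.outDeg u ∧ u ∈ st.visited ∧ u ∉ st.order

/-- The number of unvisited vertices that are not sinks. -/
def numWhite (st : SortState n) : ℕ :=
  (Finset.univ.filter fun u => 0 < D.degrees.outDeg u ∧ u ∉ st.visited).card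

omit [NeZero n] in
theorem numWhite_insert {v : Fin n} {st : SortState n} (hv : v ∉ st.visited)
    (hd : 0 < D.degrees.outDeg v) :
    D.numWhite ⟨insert v st.visited, st.order⟩ + 1 = D.numWhite st := by
  rw [numWhite, numWhite, ← Finset.card_insert_of_notMem (a := v) (by simp)]
  congr 1
  ext u
  by_cases hu : u = v
  · simp [hu, hv, hd]
  · simp [hu]

omit [NeZero n] in
theorem IsClosedOrder.mem {l : List (Fin n)} (hl : D.IsClosedOrder l) {u w : Fin n} (hu : u ∈ l)
    (h : G.Adj u w) (hw : 0 < D.degrees.outDeg w) : w ∈ l := by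
  induction l with
  | nil => simp at hu
  | cons v l ih =>
    rcases List.mem_cons.1 hu with rfl | hu
    · exact List.mem_cons_of_mem _ (hl.1 w h hw)
    · exact List.mem_cons_of_mem _ (ih hl.2 hu)

omit [NeZero n] in
-- A backward edge into the head would force the head to occur in the tail as well.
theorem IsClosedOrder.pairwise {l : List (Fin n)} (hl : D.IsClosedOrder l) (hn : l.Nodup)
    (hd : ∀ u ∈ l, 0 < D.degrees.outDeg u) : l.Pairwise fun u v => ¬ G.Adj v u := by
  induction l with
  | nil => exact List.Pairwise.nil
  | cons v l ih =>
    rw [List.nodup_cons] at hn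
    refine List.Pairwise.cons (fun u hu h => hn.1 ?_)
      (ih hl.2 hn.2 fun u hu => hd u (List.mem_cons_of_mem _ hu))
    exact hl.2.mem D hu h (hd v List.mem_cons_self)

/-- The specification of a correct depth-first search at `v` that makes `k` first-one searches. -/
structure DFSResult (v : Fin n) (st st' : SortState n) (k : ℕ) : Prop where
  inv : D.SortInv st'
  subset_visited : st.visited ⊆ st'.visited
  subset_order : st.order ⊆ st'.order
  mem_order : v ∈ st'.order
  grey : ∀ u, D.Grey st' u ↔ D.Grey st u
  count : k + 1 + 2 * D.numWhite st' ≤ 2 * D.numWhite st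

/-- The specification of a correct scan of the out-neighbours of `v` that makes `k` first-one
searches. -/
structure ScanResult (v : Fin n) (st st' : SortState n) (k : ℕ) : Prop where
  inv : D.SortInv st'
  subset_visited : st.visited ⊆ st'.visited
  subset_order : st.order ⊆ st'.order
  visited : ∀ w, G.Adj v w → 0 < D.degrees.outDeg w → w ∈ st'.visited
  grey : ∀ u, D.Grey st' u ↔ D.Grey st u
  count : k + 2 * D.numWhite st' ≤ 2 * D.numWhite st + 1

end WeightedDAG.AdjLists

open WeightedDAG.AdjLists

variable {D}

theorem QProg.failure_bind_eq_le {I A α β : Type} [AddGroup A] {x : I → A} {P : QProg I A α}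
    {k : α → QProg I A β} {a : α} {R : β → Prop} {c d : ℝ≥0∞}
    (hP : P.failure x (· = a) ≤ c) (hk : (k a).failure x R ≤ d) :
    (P.bind k).failure x R ≤ c + d :=
  QProg.failure_bind_le hP fun _ h => h ▸ hk

theorem QProg.failure_ask_bind {I A β : Type} [AddGroup A] {x : I → A} (i : I)
    (k : A → QProg I A β) (R : β → Prop) :
    ((QProg.ask i).bind k).failure x R = (k (x i)).failure x R := by
  rw [QProg.failure, QProg.expect_bind, QProg.expect_ask, QProg.failure]

/-- The state `st'` is that of the run in which all searches are correct, and a union bound over its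
`k` searches controls every deviation. The invariant is that the non-sinks among the entries before
`start` are visited. -/
theorem exists_scanResult {f : ℕ}
    (hdfs : ∀ (v : Fin n) (st : SortState n), D.SortInv st → v ∉ st.visited →
      0 < D.degrees.outDeg v → (∀ u, D.Grey st u → ¬ Relation.ReflTransGen G.Adj v u) →
      n ≤ f + st.visited.card → ∃ st' k, D.DFSResult v st st' k ∧
        (topSortDFS D.degrees f v st).failure D.oracle (· = st') ≤ k * (1 / 2) ^ numReps n)
    (v : Fin n) (g : ℕ) : ∀ (start : ℕ) (st : SortState n), D.SortInv st →
      (∀ u, D.Grey st u → ¬ Relation.TransGen G.Adj v u) →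
      (∀ p < start, ∀ w, (D.outList v)[p]? = some w → 0 < D.degrees.outDeg w → w ∈ st.visited) →
      start ≤ D.degrees.outDeg v → D.degrees.outDeg v + 1 ≤ g + start →
      n ≤ f + st.visited.card → ∃ st' k, D.ScanResult v st st' k ∧
        (topSortScan D.degrees (topSortDFS D.degrees f) v g start st).failure D.oracle (· = st') ≤
          k * (1 / 2) ^ numReps n := by
  induction g with
  | zero => intro start st _ _ _ h1 h2; omega
  | succ g ih =>
    intro start st hinv hgrey hbefore hstart hg hn
    obtain ⟨r, hr⟩ := exists_isFirstFresh D.degrees st.visited v start D.oracle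
    have hfail := failure_firstOneSearch_le hr
    rw [topSortScan_succ]
    rcases hr with ⟨rfl, hnone⟩ | ⟨z, rfl, hz, hmin⟩
    · refine ⟨st, 1, ⟨hinv, subset_rfl, List.Subset.refl _, fun w hw hd => ?_, fun u => Iff.rfl,
        by omega⟩, ?_⟩
      · obtain ⟨p, hp, hx⟩ := D.exists_outSlot hw
        by_contra hnv
        by_cases hps : start ≤ p
        · exact hnone p ⟨hps, hp, by rw [hx]; exact ⟨hnv, hd⟩⟩
        · obtain ⟨u, hu, -, hu'⟩ := D.oracle_outSlot hp
          rw [hu] at hx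
          exact hnv (hbefore p (not_le.1 hps) w (by rw [hu', (Prod.mk.inj hx).1]) hd)
      · rw [Nat.cast_one, one_mul]
        refine (QProg.failure_bind_eq_le hfail (d := 0) ?_).trans_eq (add_zero _)
        exact (QProg.failure_ret (Q := (· = st)) rfl).le
    · obtain ⟨c, hc, hadj, hcz⟩ := D.oracle_outSlot hz.2.1
      have hfresh := hz.2.2
      rw [hc] at hfresh
      obtain ⟨st₁, k₁, hr₁, hf₁⟩ := hdfs c st hinv hfresh.1 hfresh.2
        (fun u hu h => hgrey u hu (Relation.TransGen.head' hadj h)) hn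
      obtain ⟨st₂, k₂, hr₂, hf₂⟩ := ih (z + 1) st₁ hr₁.inv
        (fun u hu => hgrey u ((hr₁.grey u).1 hu))
        -- The entry `z` has just been finished, entries before `start` were visited already, and
        -- those in between are not fresh because `z` is the first.
        (fun p hp w hw hd => by
          by_cases hpz : p = z
          · subst hpz
            rw [hcz, Option.some_inj] at hw
            subst hw
            exact hr₁.inv.visited _ hr₁.mem_order
          · by_cases hps : p < start
            · exact hr₁.subset_visited (hbefore p hps w hw hd)
            · refine hr₁.subset_visited ?_
              by_contra hnv
              have hpd : p < D.degrees.outDeg v := by have := hz.2.1; omega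
              obtain ⟨u, hu, -, hu'⟩ := D.oracle_outSlot hpd
              rw [hu', Option.some_inj] at hw
              subst hw
              have := hmin p ⟨not_lt.1 hps, hpd, by rw [hu]; exact ⟨hnv, hd⟩⟩
              omega)
        hz.2.1 (by have := hz.1; omega)
        (hn.trans (by gcongr; exact hr₁.subset_visited))
      refine ⟨st₂, 1 + (k₁ + k₂), ⟨hr₂.inv, hr₁.subset_visited.trans hr₂.subset_visited,
        List.Subset.trans hr₁.subset_order hr₂.subset_order, hr₂.visited,
        fun u => (hr₂.grey u).trans (hr₁.grey u), ?_⟩, ?_⟩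
      · have := hr₁.count
        have := hr₂.count
        omega
      · push_cast
        rw [add_mul, one_mul, add_mul]
        refine QProg.failure_bind_eq_le hfail ?_
        simp only [Option.elim]
        rw [QProg.failure_ask_bind, hc]
        exact QProg.failure_bind_eq_le hf₁ hf₂

/-- No grey vertex is reachable from `v`; otherwise the vertices under exploration, which lead to
`v`, would close a cycle. Hence every non-sink out-neighbour of `v` is finished when `v` is put in
front of the order. -/
theorem exists_dfsResult (f : ℕ) : ∀ (v : Fin n) (st : SortState n), D.SortInv st →
    v ∉ st.visited → 0 < D.degrees.outDeg v →
    (∀ u, D.Grey st u → ¬ Relation.ReflTransGen G.Adj v u) →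
    n ≤ f + st.visited.card → ∃ st' k, D.DFSResult v st st' k ∧
      (topSortDFS D.degrees f v st).failure D.oracle (· = st') ≤ k * (1 / 2) ^ numReps n := by
  induction f with
  | zero =>
    intro v st _ hv _ _ hn
    have := Finset.card_lt_univ_of_notMem hv
    rw [Fintype.card_fin] at this
    omega
  | succ f ih =>
    intro v st hinv hv hd hgrey hn
    have hvo : v ∉ st.order := fun h => hv (hinv.visited v h)
    set st₀ : SortState n := ⟨insert v st.visited, st.order⟩ with hst₀
    have hinv₀ : D.SortInv st₀ := ⟨hinv.nodup,
      fun u hu => Finset.mem_insert_of_mem (hinv.visited u hu), hinv.outDeg_pos, hinv.closed⟩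
    have hgrey₀ : ∀ u, D.Grey st₀ u ↔ u = v ∨ D.Grey st u := by
      intro u
      by_cases hu : u = v
      · subst hu
        simp [Grey, hst₀, hd, hvo]
      · simp [Grey, hst₀, hu]
    have hgreyv : ∀ u, D.Grey st₀ u → ¬ Relation.TransGen G.Adj v u := by
      intro u hu h
      rcases (hgrey₀ u).1 hu with rfl | hu
      · exact G.acyclic _ h
      · exact hgrey u hu h.to_reflTransGen
    obtain ⟨st', k, hr, hf⟩ := exists_scanResult ih v (D.degrees.outDeg v + 1) 0 st₀ hinv₀ hgreyv
      (by simp) zero_le le_rfl (by rw [hst₀, Finset.card_insert_of_notMem hv]; omega)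
    -- The scan preserves the grey vertices, so `v` itself has not been added to the order
    -- meanwhile.
    have hv' : D.Grey st' v := (hr.grey v).2 ((hgrey₀ v).2 (Or.inl rfl))
    refine ⟨⟨st'.visited, v :: st'.order⟩, k, ⟨⟨?_, ?_, ?_, ?_, hr.inv.closed⟩, ?_, ?_, ?_, ?_, ?_⟩,
      ?_⟩
    · exact List.nodup_cons.2 ⟨hv'.2.2, hr.inv.nodup⟩
    · intro u hu
      rcases List.mem_cons.1 hu with rfl | hu
      · exact hv'.2.1
      · exact hr.inv.visited u hu
    · intro u hu
      rcases List.mem_cons.1 hu with rfl | hu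
      · exact hd
      · exact hr.inv.outDeg_pos u hu
    · intro w hw hwd
      by_contra hwo
      exact hgreyv w ((hr.grey w).1 ⟨hwd, hr.visited w hw hwd, hwo⟩) (Relation.TransGen.single hw)
    · exact (Finset.subset_insert _ _).trans hr.subset_visited
    · exact List.Subset.trans hr.subset_order (List.subset_cons_self _ _)
    · exact List.mem_cons_self
    · intro u
      by_cases hu : u = v
      · subst hu
        simp [Grey, hv]
      · have h1 : D.Grey ⟨st'.visited, v :: st'.order⟩ u ↔ D.Grey st' u := by simp [Grey, hu]
        rw [h1, hr.grey, hgrey₀]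
        simp [hu]
    -- Visiting `v` lowers `numWhite` by one, worth `2`: this covers the final search of the scan
    -- and the `+ 1` owed to the search that found `v`.
    · have h1 := hr.count
      have h2 := D.numWhite_insert hv hd
      change k + 1 + 2 * D.numWhite st' ≤ _
      rw [← hst₀] at h2
      omega
    · rw [topSortDFS_succ hd]
      refine (QProg.failure_bind_eq_le hf (d := 0) ?_).trans_eq (add_zero _)
      exact (QProg.failure_ret (Q := (· = _)) rfl).le

theorem exists_topSortFrom_result (l : List (Fin n)) : ∀ st : SortState n, D.SortInv st →
    (∀ u, ¬ D.Grey st u) → ∃ st' k, D.SortInv st' ∧ st.order ⊆ st'.order ∧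
      (∀ v ∈ l, 0 < D.degrees.outDeg v → v ∈ st'.order) ∧
      k + 2 * D.numWhite st' ≤ 2 * D.numWhite st ∧
      (topSortFrom D.degrees l st).failure D.oracle (· = st') ≤ k * (1 / 2) ^ numReps n := by
  induction l with
  | nil =>
    intro st hinv _
    refine ⟨st, 0, hinv, List.Subset.refl _, by simp, by omega, ?_⟩
    exact ((QProg.failure_ret (Q := (· = st)) rfl).le).trans zero_le
  | cons v l ih =>
    intro st hinv hgrey
    rw [topSortFrom]
    split_ifs with hv
    · obtain ⟨st', k, h1, h2, h3, h4, h5⟩ := ih st hinv hgrey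
      refine ⟨st', k, h1, h2, fun u hu hd => ?_, h4, h5⟩
      rcases List.mem_cons.1 hu with rfl | hu
      · by_contra huo
        exact hgrey u ⟨hd, hv, fun h => huo (h2 h)⟩
      · exact h3 u hu hd
    · by_cases hd : 0 < D.degrees.outDeg v
      · obtain ⟨st₁, k₁, hr, hf⟩ := exists_dfsResult n v st hinv hv hd
          (fun u hu => absurd hu (hgrey u)) le_self_add
        obtain ⟨st', k, h1, h2, h3, h4, h5⟩ := ih st₁ hr.inv fun u hu => hgrey u ((hr.grey u).1 hu)
        refine ⟨st', k₁ + k, h1, List.Subset.trans hr.subset_order h2, fun u hu hd => ?_, ?_, ?_⟩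
        · rcases List.mem_cons.1 hu with rfl | hu
          · exact h2 hr.mem_order
          · exact h3 u hu hd
        · have := hr.count
          omega
        · rw [Nat.cast_add, add_mul]
          exact QProg.failure_bind_eq_le hf h5
      · have hvo : v ∉ st.order := fun h => hv (hinv.visited v h)
        obtain ⟨st', k, h1, h2, h3, h4, h5⟩ := ih ⟨insert v st.visited, st.order⟩
          ⟨hinv.nodup, fun u hu => Finset.mem_insert_of_mem (hinv.visited u hu), hinv.outDeg_pos,
            hinv.closed⟩ (by
            rintro u ⟨hu1, hu2, hu3⟩
            rcases Finset.mem_insert.1 hu2 with rfl | hu2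
            · exact hd hu1
            · exact hgrey u ⟨hu1, hu2, hu3⟩)
        refine ⟨st', k, h1, h2, fun u hu hud => ?_, h4.trans ?_, ?_⟩
        · rcases List.mem_cons.1 hu with rfl | hu
          · exact absurd hud hd
          · exact h3 u hu hud
        · refine Nat.mul_le_mul_left 2 (Finset.card_le_card fun u hu => ?_)
          simp only [Finset.mem_filter, Finset.mem_insert, not_or] at hu ⊢
          exact ⟨hu.1, hu.2.1, hu.2.2.2⟩
        · change QProg.failure _ (QProg.bind _ _) _ ≤ _
          refine (QProg.failure_bind_eq_le (c := 0) ?_ h5).trans_eq (zero_add _)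
          obtain ⟨m, rfl⟩ := Nat.exists_eq_succ_of_ne_zero (NeZero.ne n)
          rw [topSortDFS_succ_of_sink hd]
          exact (QProg.failure_ret (Q := (· = _)) rfl).le

omit [NeZero n] in
theorem WeightedDAG.wellFounded_adj (G : WeightedDAG n) : WellFounded G.Adj := by
  have : IsTrans (Fin n) (Relation.TransGen G.Adj) := ⟨fun _ _ _ => Relation.TransGen.trans⟩
  have : Std.Irrefl (Relation.TransGen G.Adj) := ⟨G.acyclic⟩
  exact Subrelation.wf (fun h => Relation.TransGen.single h)
    (Finite.wellFounded_of_trans_of_irrefl (Relation.TransGen G.Adj))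

/-- Except with probability `2 n / 2 ^ numReps n`, the topological sort returns a certain order of the
vertices without backward edges. -/
theorem exists_topSort_result : ∃ l : List (Fin n), l.Nodup ∧ (∀ v, v ∈ l) ∧
    (l.Pairwise fun u v => ¬ G.Adj v u) ∧
    (topSort D.degrees).failure D.oracle (· = l) ≤ (2 * n : ℕ) * (1 / 2) ^ numReps n := by
  obtain ⟨st, k, hinv, -, hsrc, hk, hf⟩ := exists_topSortFrom_result (D := D)
    ((List.finRange n).filter fun v => D.degrees.inDeg v = 0) ⟨∅, []⟩
    ⟨List.nodup_nil, by simp, by simp, trivial⟩ (by simp [Grey])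
  -- In an acyclic graph every vertex is reached from a source; all predecessors are non-sinks, and
  -- the order is closed under non-sink out-neighbours.
  have hall : ∀ v, 0 < D.degrees.outDeg v → v ∈ st.order := by
    intro v
    induction v using G.wellFounded_adj.induction with
    | _ v ih =>
      intro hd
      by_cases h : ∃ u, G.Adj u v
      · obtain ⟨u, hu⟩ := h
        exact hinv.closed.mem D (ih u hu (D.outDeg_pos_iff.2 ⟨v, hu⟩)) hu hd
      · refine hsrc v ?_ hd
        push Not at h
        simpa using D.inDeg_eq_zero_iff.2 h
  refine ⟨st.order ++ (List.finRange n).filter fun v => D.degrees.outDeg v = 0, ?_, ?_, ?_, ?_⟩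
  · refine List.Nodup.append hinv.nodup ((List.nodup_finRange n).filter _) ?_
    intro u hu hu'
    have h1 := hinv.outDeg_pos u hu
    have h2 : D.degrees.outDeg u = 0 := by simpa using hu'
    omega
  · intro v
    rw [List.mem_append]
    by_cases hd : 0 < D.degrees.outDeg v
    · exact Or.inl (hall v hd)
    · exact Or.inr (by simpa using hd)
  · have hsink : ∀ v ∈ (List.finRange n).filter fun v => D.degrees.outDeg v = 0,
        ∀ u, ¬ G.Adj v u := by
      intro v hv u h
      have h1 := D.outDeg_pos_iff.2 ⟨u, h⟩
      have h2 : D.degrees.outDeg v = 0 := by simpa using hv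
      omega
    refine List.pairwise_append.2 ⟨hinv.closed.pairwise D hinv.nodup hinv.outDeg_pos, ?_,
      fun u _ v hv => hsink v hv u⟩
    exact List.Pairwise.imp_of_mem (R := fun _ _ => True) (fun _ hv _ => hsink _ hv _)
      (List.pairwise_of_forall fun _ _ => trivial)
  · rw [topSort_eq]
    refine (QProg.failure_bind_eq_le hf (d := 0) ?_).trans ?_
    · exact (QProg.failure_ret (Q := (· = _)) rfl).le
    · rw [add_zero]
      gcongr
      have : D.numWhite (⟨∅, []⟩ : SortState n) ≤ n := by
        refine (Finset.card_le_univ _).trans_eq (Fintype.card_fin n)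
      omega

end Correctness

/-! ## The relaxation of the vertices in topological order -/

section Relax

variable {n : ℕ} [NeZero n]

theorem maxOverIn_eq {deg : Degrees n} {v : Fin n} (h : (inBlock deg v).Nonempty)
    (t : Fin n → WithBot ℝ) :
    maxOverIn deg t v = (durrHoyerMax (inBlock deg v) h
      (fun _ a => t a.1 + (a.2 : WithBot ℝ))).bind fun y =>
        QProg.ret (t y.2.1 + (y.2.2 : WithBot ℝ)) := by
  rw [maxOverIn, dif_pos h]
  rfl

theorem maxOverIn_eq_of_empty {deg : Degrees n} {v : Fin n} (h : ¬ (inBlock deg v).Nonempty)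
    (t : Fin n → WithBot ℝ) : maxOverIn deg t v = QProg.ret ⊥ := by
  rw [maxOverIn, dif_neg h]
  rfl

theorem relaxLoop_cons {deg : Degrees n} (v : Fin n) (l : List (Fin n)) (t : Fin n → WithBot ℝ) :
    relaxLoop deg (v :: l) t = (QProg.boost max ⊥ (maxOverIn deg t v) (numReps n)).bind fun r =>
      relaxLoop deg l (Function.update t v r) := rfl

omit [NeZero n] in
theorem card_inBlock_le (deg : Degrees n) (v : Fin n) : (inBlock deg v).card ≤ deg.inDeg v := by
  classical
  exact Finset.card_image_le.trans_eq (Finset.card_range _)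

theorem expectedQueries_maxOverIn_le {deg : Degrees n} {x : Slot n → EdgeInfo n}
    (t : Fin n → WithBot ℝ) (v : Fin n) :
    (maxOverIn deg t v).expectedQueries x ≤ ENNReal.ofReal (258 * √(deg.inDeg v : ℝ)) := by
  by_cases h : (inBlock deg v).Nonempty
  · rw [maxOverIn_eq h]
    refine (QProg.expectedQueries_bind_le (c := 0) (QProg.surely_true _) fun y _ => ?_).trans ?_
    · rw [QProg.expectedQueries_ret]
    · rw [add_zero]
      refine expectedQueries_durrHoyerMax_le.trans (ENNReal.ofReal_le_ofReal ?_)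
      refine mul_le_mul_of_nonneg_left (Real.sqrt_le_sqrt ?_) (by norm_num)
      exact_mod_cast card_inBlock_le deg v
  · rw [maxOverIn_eq_of_empty h, QProg.expectedQueries_ret]
    exact zero_le

theorem expectedQueries_relaxLoop_le {deg : Degrees n} {x : Slot n → EdgeInfo n}
    (l : List (Fin n)) : ∀ t : Fin n → WithBot ℝ,
    (relaxLoop deg l t).expectedQueries x ≤
      (l.map fun v => ENNReal.ofReal (258 * numReps n * √(deg.inDeg v : ℝ))).sum := by
  induction l with
  | nil =>
    intro t
    exact (QProg.expectedQueries_ret t).trans_le zero_le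
  | cons v l ih =>
    intro t
    rw [relaxLoop_cons, List.map_cons, List.sum_cons]
    refine (QProg.expectedQueries_bind_le (QProg.surely_true _) fun r _ => ih _).trans ?_
    gcongr
    rw [QProg.expectedQueries_boost, mul_comm (258 : ℝ), mul_assoc,
      ENNReal.ofReal_mul (Nat.cast_nonneg _), ENNReal.ofReal_natCast]
    gcongr
    exact expectedQueries_maxOverIn_le t v

/-! ### Correctness of the relaxation -/

namespace WeightedDAG

variable {G : WeightedDAG n} {D : G.AdjLists}

/-- `r` is the maximum of `t u + weight u v` over the in-neighbours `u` of `v`. -/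
def IsMaxIn (G : WeightedDAG n) (t : Fin n → WithBot ℝ) (v : Fin n) (r : WithBot ℝ) : Prop :=
  (∀ u, G.Adj u v → t u + (G.weight u v : WithBot ℝ) ≤ r) ∧
    (r = ⊥ ∨ ∃ u, G.Adj u v ∧ t u + (G.weight u v : WithBot ℝ) = r)

omit [NeZero n] in
theorem exists_isMaxIn (G : WeightedDAG n) (t : Fin n → WithBot ℝ) (v : Fin n) :
    ∃ r, G.IsMaxIn t v r := by
  classical
  by_cases h : (Finset.univ.filter fun u => G.Adj u v).Nonempty
  · obtain ⟨u, hu, hmax⟩ := Finset.exists_max_image _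
      (fun u => t u + (G.weight u v : WithBot ℝ)) h
    exact ⟨_, fun u' hu' => hmax u' (by simpa using hu'), Or.inr ⟨u, by simpa using hu, rfl⟩⟩
  · refine ⟨⊥, fun u hu => absurd ⟨u, by simpa using hu⟩ h, Or.inl rfl⟩

namespace AdjLists

theorem oracle_inSlot {v : Fin n} {i : Slot n} (hi : i ∈ inBlock D.degrees v) :
    ∃ u, D.oracle i = (u, G.weight u v) ∧ G.Adj u v := by
  classical
  obtain ⟨p, hp, rfl⟩ := Finset.mem_image.1 hi
  have hp' : p < (D.inList v).length := Finset.mem_range.1 hp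
  refine ⟨(D.inList v)[p], ?_, (D.mem_inList _ _).1 (List.getElem_mem hp')⟩
  simp [oracle, List.getElem?_eq_getElem hp']

theorem exists_inSlot {u v : Fin n} (h : G.Adj u v) :
    ∃ i ∈ inBlock D.degrees v, D.oracle i = (u, G.weight u v) := by
  classical
  obtain ⟨p, hp, hw⟩ := List.getElem_of_mem ((D.mem_inList u v).2 h)
  exact ⟨.inSlot v p, Finset.mem_image_of_mem _ (Finset.mem_range.2 hp),
    by simp [oracle, List.getElem?_eq_getElem hp, hw]⟩

end AdjLists

theorem surely_maxOverIn {t : Fin n → WithBot ℝ} {v : Fin n} {r : WithBot ℝ}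
    (hr : G.IsMaxIn t v r) : (maxOverIn D.degrees t v).Surely D.oracle (· ≤ r) := by
  by_cases h : (inBlock D.degrees v).Nonempty
  · rw [maxOverIn_eq h]
    refine QProg.surely_bind surely_durrHoyerMax fun y hy => QProg.surely_ret ?_
    obtain ⟨u, hu, hadj⟩ := AdjLists.oracle_inSlot hy.1
    rw [hy.2, hu]
    exact hr.1 u hadj
  · rw [maxOverIn_eq_of_empty h]
    exact QProg.surely_ret bot_le

theorem failure_maxOverIn_le {t : Fin n → WithBot ℝ} {v : Fin n} {r : WithBot ℝ}
    (hr : G.IsMaxIn t v r) :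
    (maxOverIn D.degrees t v).failure D.oracle (· = r) ≤ 1 / 2 := by
  -- The result is surely at most `r`, so only `r ≤ ·` can fail.
  refine (QProg.failure_mono_of_surely (Q := (r ≤ ·)) (surely_maxOverIn hr)
    fun a h1 h2 => le_antisymm h1 h2).trans ?_
  rcases hr.2 with rfl | ⟨u, hu, rfl⟩
  · rw [QProg.failure_eq_zero ((QProg.surely_true _).mono fun _ _ => bot_le)]
    exact zero_le
  · obtain ⟨i, hi, hx⟩ := AdjLists.exists_inSlot (D := D) hu
    rw [maxOverIn_eq ⟨i, hi⟩]
    refine (QProg.failure_bind_le failure_durrHoyerMax_le (d := 0) fun y hy => ?_).trans_eq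
      (add_zero _)
    have h := hy i hi
    rw [hx] at h
    rw [QProg.failure_eq_zero (QProg.surely_ret h)]

theorem failure_boost_maxOverIn_le {t : Fin n → WithBot ℝ} {v : Fin n} {r : WithBot ℝ}
    (hr : G.IsMaxIn t v r) (k : ℕ) :
    (QProg.boost max ⊥ (maxOverIn D.degrees t v) k).failure D.oracle (· = r) ≤ (1 / 2) ^ k := by
  refine (QProg.failure_boost_le (surely_maxOverIn hr) bot_le (fun a b ha hb => max_le ha hb)
    (fun b hb => max_eq_left hb) (fun b hb => max_eq_right hb) k).trans ?_
  gcongr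
  exact failure_maxOverIn_le hr

/-- `r` is the length of the longest path from `s` to `v`. -/
def IsLongest (G : WeightedDAG n) (s v : Fin n) (r : WithBot ℝ) : Prop :=
  (r = ⊥ ∧ ∀ ℓ, ¬ G.PathOfLength s v ℓ) ∨
    ∃ ℓ : ℝ, r = (ℓ : WithBot ℝ) ∧ IsGreatest {ℓ' | G.PathOfLength s v ℓ'} ℓ

omit [NeZero n] in
theorem PathOfLength.reflTransGen {s v : Fin n} {ℓ : ℝ} (h : G.PathOfLength s v ℓ) :
    Relation.ReflTransGen G.Adj s v := by
  induction h with
  | nil => exact .refl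
  | snoc _ e ih => exact ih.tail e

omit [NeZero n] in
-- By acyclicity the empty path is the only path from `s` to itself.
theorem isLongest_self (s : Fin n) : G.IsLongest s s 0 := by
  refine Or.inr ⟨0, rfl, .nil, fun ℓ hℓ => ?_⟩
  cases hℓ with
  | nil => exact le_rfl
  | snoc p e => exact absurd (Relation.TransGen.tail' p.reflTransGen e) (G.acyclic _)

omit [NeZero n] in
-- A path from `s` to `v ≠ s` is a path to some in-neighbour of `v` followed by one edge.
theorem IsMaxIn.isLongest {s v : Fin n} {t : Fin n → WithBot ℝ} {r : WithBot ℝ}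
    (hr : G.IsMaxIn t v r) (hv : v ≠ s) (ht : ∀ u, G.Adj u v → G.IsLongest s u (t u)) :
    G.IsLongest s v r := by
  have hpath : ∀ u ℓ, G.Adj u v → G.PathOfLength s u ℓ →
      ((ℓ + G.weight u v : ℝ) : WithBot ℝ) ≤ r := by
    intro u ℓ hu hp
    refine le_trans ?_ (hr.1 u hu)
    rcases ht u hu with ⟨-, hn⟩ | ⟨ℓ', hℓ', hg⟩
    · exact absurd hp (hn ℓ)
    · rw [hℓ', ← WithBot.coe_add, WithBot.coe_le_coe]
      have := hg.2 hp
      linarith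
  by_cases hbot : r = ⊥
  · refine Or.inl ⟨hbot, fun ℓ hℓ => ?_⟩
    cases hℓ with
    | nil => exact hv rfl
    | snoc p e =>
      have := hpath _ _ e p
      rw [hbot] at this
      simp at this
  · obtain ⟨u, hu, hur⟩ := hr.2.resolve_left hbot
    rcases ht u hu with ⟨htu, -⟩ | ⟨ℓ, hℓ, hg⟩
    · rw [htu, WithBot.bot_add] at hur
      exact absurd hur.symm hbot
    · refine Or.inr ⟨ℓ + G.weight u v, by rw [← hur, hℓ, WithBot.coe_add], hg.1.snoc hu, ?_⟩
      intro ℓ' hℓ'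
      cases hℓ' with
      | nil => exact absurd rfl hv
      | snoc p e =>
        have := hpath _ _ e p
        rwa [← hur, hℓ, ← WithBot.coe_add, WithBot.coe_le_coe] at this

/-- As there are no backward edges, all in-neighbours of the next vertex are in `done` and have
final values. The correct run is deterministic, and a union bound covers one maximum per vertex. -/
theorem exists_relaxLoop_result {s : Fin n} (l : List (Fin n)) :
    ∀ (done : List (Fin n)) (t : Fin n → WithBot ℝ), (done ++ l).Nodup → (∀ v, v ∈ done ++ l) →
      ((done ++ l).Pairwise fun u v => ¬ G.Adj v u) → s ∈ done →
      (∀ v ∈ done, G.IsLongest s v (t v)) →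
      ∃ t', (∀ v, G.IsLongest s v (t' v)) ∧
        (relaxLoop D.degrees l t).failure D.oracle (· = t') ≤
          l.length * (1 / 2) ^ numReps n := by
  induction l with
  | nil =>
    intro done t _ hmem _ _ ht
    rw [List.append_nil] at hmem
    exact ⟨t, fun v => ht v (hmem v),
      ((QProg.failure_ret (Q := (· = t)) rfl).le).trans zero_le⟩
  | cons v l ih =>
    intro done t hnd hmem hpw hs ht
    obtain ⟨r, hr⟩ := G.exists_isMaxIn t v
    have hvd : v ∉ done := fun h => (List.disjoint_of_nodup_append hnd) h List.mem_cons_self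
    have hin : ∀ u, G.Adj u v → u ∈ done := by
      intro u hu
      rcases List.mem_append.1 (hmem u) with h | h
      · exact h
      · exfalso
        rcases List.mem_cons.1 h with rfl | h
        · exact G.acyclic _ (Relation.TransGen.single hu)
        · exact (List.pairwise_cons.1 (List.pairwise_append.1 hpw).2.1).1 u h hu
    have hlong : G.IsLongest s v r :=
      hr.isLongest (fun h => hvd (h ▸ hs)) fun u hu => ht u (hin u hu)
    have e : done ++ v :: l = (done ++ [v]) ++ l := by simp
    rw [e] at hnd hmem hpw
    obtain ⟨t', ht', hf⟩ := ih (done ++ [v]) (Function.update t v r) hnd hmem hpw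
      (List.mem_append_left _ hs) (fun u hu => by
        by_cases huv : u = v
        · subst huv
          rwa [Function.update_self]
        · rw [Function.update_of_ne huv]
          exact ht u (by simpa [huv] using hu))
    refine ⟨t', ht', ?_⟩
    rw [relaxLoop_cons, List.length_cons, Nat.cast_add, Nat.cast_one, add_comm, add_mul, one_mul]
    exact QProg.failure_bind_eq_le (failure_boost_maxOverIn_le hr _) hf

omit [NeZero n] in
theorem dropWhile_ne_append_cons {s : Fin n} {l₁ : List (Fin n)} (h : s ∉ l₁) (l₂ : List (Fin n)) :
    (l₁ ++ s :: l₂).dropWhile (fun v => v ≠ s) = s :: l₂ := by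
  rw [List.dropWhile_append_of_pos]
  · simp
  · intro v hv
    simpa using fun hvs : v = s => h (hvs ▸ hv)

/-- If the order of the vertices is correct, then so is the result of the main loop, except with
probability `n / 2 ^ numReps n`. -/
theorem failure_relaxLoop_le {s : Fin n} {order : List (Fin n)} (hnd : order.Nodup)
    (hmem : ∀ v, v ∈ order) (hpw : order.Pairwise fun u v => ¬ G.Adj v u) :
    (relaxLoop D.degrees (order.dropWhile (fun v => v ≠ s)).tail
      (Function.update (fun _ => ⊥) s 0)).failure D.oracle (· ∈ G.longestPathSolutions s) ≤
      n * (1 / 2) ^ numReps n := by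
  obtain ⟨l₁, l₂, rfl⟩ := List.append_of_mem (hmem s)
  have hs : s ∉ l₁ := fun h => (List.disjoint_of_nodup_append hnd) h List.mem_cons_self
  have hlen : l₂.length ≤ n := by
    have := hnd.length_le_card
    rw [Fintype.card_fin, List.length_append, List.length_cons] at this
    omega
  -- Vertices before `s` are unreachable from `s`, as some edge of a path to them would go backward;
  -- their initial value `⊥` is final.
  have hun : ∀ v ℓ, G.PathOfLength s v ℓ → v ∉ l₁ := by
    intro v ℓ hp
    induction hp with
    | nil => exact hs
    | @snoc v w ℓ p e ih =>
      intro hw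
      rcases List.mem_append.1 (hmem v) with h | h
      · exact ih h
      · exact (List.pairwise_append.1 hpw).2.2 w hw v h e
  rw [dropWhile_ne_append_cons hs, List.tail_cons]
  have e : l₁ ++ s :: l₂ = (l₁ ++ [s]) ++ l₂ := by simp
  rw [e] at hnd hmem hpw
  obtain ⟨t, ht, hf⟩ := exists_relaxLoop_result (D := D) (s := s) l₂ (l₁ ++ [s])
    (Function.update (fun _ => ⊥) s 0) hnd hmem hpw (by simp) (fun v hv => by
      by_cases hvs : v = s
      · subst hvs
        rw [Function.update_self]
        exact isLongest_self v
      · rw [Function.update_of_ne hvs]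
        exact Or.inl ⟨rfl, fun ℓ hℓ => hun v ℓ hℓ (by simpa [hvs] using hv)⟩)
  refine (QProg.failure_mono (Q := (· = t)) fun t' h => ?_).trans (hf.trans ?_)
  · rw [h]
    exact ht
  · gcongr

end WeightedDAG

end Relax

/-! ## The algorithm -/

section Main

variable {n : ℕ} [NeZero n] {G : WeightedDAG n} (D : G.AdjLists)

theorem longestPathAlgorithm_eq (deg : Degrees n) (s : Fin n) :
    longestPathAlgorithm deg s = (topSort deg).bind fun order =>
      relaxLoop deg (order.dropWhile (fun v => v ≠ s)).tail
        (Function.update (fun _ => ⊥) s 0) := rfl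

theorem half_pow_numReps_le : (1 / 2 : ℝ≥0∞) ^ numReps n ≤ ENNReal.ofReal (1 / (n : ℝ) ^ 2) := by
  have h : ((n : ℝ) ^ 2) ≤ 2 ^ numReps n := by
    exact_mod_cast Nat.le_pow_clog one_lt_two (n ^ 2)
  have hn : (0 : ℝ) < n := by exact_mod_cast NeZero.pos n
  have e : (1 / 2 : ℝ≥0∞) = ENNReal.ofReal (1 / 2) := by
    rw [ENNReal.ofReal_div_of_pos (by norm_num)]; norm_num
  rw [e, ← ENNReal.ofReal_pow (by norm_num), one_div_pow]
  refine ENNReal.ofReal_le_ofReal ?_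
  gcongr

theorem errorProb_longestPathAlgorithm_le (s : Fin n) :
    (longestPathAlgorithm D.degrees s).errorProb D.oracle (G.longestPathSolutions s) ≤
      ENNReal.ofReal (3 / (n : ℝ)) := by
  obtain ⟨order, hnd, hmem, hpw, hf⟩ := exists_topSort_result (D := D)
  rw [QProg.errorProb_eq_failure, longestPathAlgorithm_eq]
  refine (QProg.failure_bind_eq_le hf (WeightedDAG.failure_relaxLoop_le hnd hmem hpw)).trans ?_
  have hn : (0 : ℝ) < n := by exact_mod_cast NeZero.pos n
  calc _ = (3 * n : ℕ) * (1 / 2 : ℝ≥0∞) ^ numReps n := by push_cast; ring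
    _ ≤ (3 * n : ℕ) * ENNReal.ofReal (1 / (n : ℝ) ^ 2) := by gcongr; exact half_pow_numReps_le
    _ = _ := by
      rw [← ENNReal.ofReal_natCast, ← ENNReal.ofReal_mul (Nat.cast_nonneg _)]
      congr 1
      push_cast
      field_simp

/-! ### The query bound -/

omit [NeZero n] in
-- The ceiling costs at most one more than `2 log n / log 2`; for `n ≥ 2` that one is absorbed,
-- since `log n ≥ log 2`.
theorem numReps_le_log (hn : 2 ≤ n) : (numReps n : ℝ) ≤ 5 * Real.log n := by
  have hlog2 := Real.log_two_gt_d9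
  have hn0 : (0 : ℝ) < n := by positivity
  have hlog : Real.log 2 ≤ Real.log n := Real.log_le_log (by norm_num) (by exact_mod_cast hn)
  have h1 : 2 ^ (numReps n).pred < n ^ 2 :=
    Nat.pow_pred_clog_lt_self one_lt_two (by nlinarith)
  have h2 : ((2 : ℝ) ^ (numReps n).pred) ≤ (n : ℝ) ^ 2 := by exact_mod_cast h1.le
  have h3 := Real.log_le_log (by positivity) h2
  rw [Real.log_pow, Real.log_pow] at h3
  have h4 : (numReps n : ℝ) ≤ (numReps n).pred + 1 := by
    have : numReps n ≤ (numReps n).pred + 1 := by rw [Nat.pred_eq_sub_one]; omega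
    exact_mod_cast this
  have h5 : (0 : ℝ) ≤ (numReps n).pred := Nat.cast_nonneg _
  push_cast at h3
  nlinarith

namespace WeightedDAG.AdjLists

omit [NeZero n] in
theorem sum_outDeg : ∑ v, D.degrees.outDeg v = G.numEdges := by
  classical
  rw [numEdges, Set.ncard_eq_toFinset_card', Set.toFinset_ofPred, Finset.card_filter,
    Fintype.sum_prod_type]
  refine Finset.sum_congr rfl fun v _ => ?_
  rw [← Finset.card_filter]
  change (D.outList v).length = _
  rw [← List.toFinset_card_of_nodup (D.nodup_outList v)]
  congr 1
  ext w
  simp [D.mem_outList]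

omit [NeZero n] in
theorem sum_inDeg : ∑ v, D.degrees.inDeg v = G.numEdges := by
  classical
  rw [numEdges, Set.ncard_eq_toFinset_card', Set.toFinset_ofPred, Finset.card_filter,
    Fintype.sum_prod_type_right]
  refine Finset.sum_congr rfl fun v _ => ?_
  rw [← Finset.card_filter]
  change (D.inList v).length = _
  rw [← List.toFinset_card_of_nodup (D.nodup_inList v)]
  congr 1
  ext w
  simp [D.mem_inList]

end WeightedDAG.AdjLists

/-- The expected cost of the algorithm in terms of a linear bound `a m + b` for the cost of a search
among `m` items. -/
theorem expectedQueries_longestPathAlgorithm_le_linear {a b : ℝ≥0∞}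
    (hab : ∀ m : ℕ, 1 ≤ m → ENNReal.ofReal (2580 * numReps n * √(m : ℝ)) + 1 ≤ a * m + b)
    (s : Fin n) :
    (longestPathAlgorithm D.degrees s).expectedQueries D.oracle ≤
      (∑ u, if 0 < D.degrees.outDeg u then a * D.degrees.outDeg u + 2 * b +
        ENNReal.ofReal (258 * numReps n * √(D.degrees.inDeg u : ℝ)) else 0) +
      ∑ u, ENNReal.ofReal (258 * numReps n * √(D.degrees.inDeg u : ℝ)) := by
  rw [longestPathAlgorithm_eq, QProg.expectedQueries_bind]
  refine le_trans (add_le_add le_rfl (QProg.expect_mono fun order => ?_))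
    (amortizedCost_topSort_le hab (ρ := fun u =>
      -- The weight `ρ u` is the cost of relaxing `u`, so the amortized cost of the sort already
      -- contains the main loop for whatever order is returned.
      ENNReal.ofReal (258 * numReps n * √(D.degrees.inDeg u : ℝ))) fun u hu => ?_)
  · refine (expectedQueries_relaxLoop_le _ _).trans ?_
    have hsub : (order.dropWhile (fun v => v ≠ s)).tail.Sublist order :=
      (List.tail_sublist _).trans (List.dropWhile_sublist _)
    exact (hsub.map _).sum_le_sum fun _ _ => zero_le
  · rw [if_pos hu]

theorem expectedQueries_longestPathAlgorithm_le (s : Fin n) :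
    (longestPathAlgorithm D.degrees s).expectedQueries D.oracle ≤
      ENNReal.ofReal (100000 * (√((n : ℝ) * (G.numEdges : ℝ)) * Real.log (n : ℝ))) := by
  have hout := D.sum_outDeg
  have hin := D.sum_inDeg
  rcases Nat.eq_zero_or_pos G.numEdges with hm | hm
  · rw [hm, Finset.sum_eq_zero_iff] at hout hin
    -- Without edges all degrees vanish and so do all terms of the bound, whatever `a` and `b` are;
    -- `⊤` satisfies the hypothesis trivially.
    refine (expectedQueries_longestPathAlgorithm_le_linear D (a := ⊤) (b := ⊤)
      (by simp) s).trans ?_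
    simp [hout, hin]
  set m := G.numEdges
  have hn0 : (0 : ℝ) < n := by exact_mod_cast NeZero.pos n
  have hm0 : (0 : ℝ) < m := by exact_mod_cast hm
  -- An edge needs two vertices by acyclicity; this makes `log n` positive.
  have hn2 : 2 ≤ n := by
    by_contra hlt
    have h1 : n = 1 := by have := NeZero.pos n; omega
    subst h1
    obtain ⟨u, -, hu⟩ := Finset.exists_ne_zero_of_sum_ne_zero (hout.trans_ne hm.ne')
    obtain ⟨w, hw⟩ := D.outDeg_pos_iff.1 (Nat.pos_of_ne_zero hu)
    rw [Subsingleton.elim w u] at hw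
    exact G.acyclic u (Relation.TransGen.single hw)
  -- This choice balances the two totals: `α m = n / α = √(n m)`.
  set α := √((n : ℝ) / m) with hα
  have hα0 : 0 < α := Real.sqrt_pos.2 (by positivity)
  set K : ℝ := 2580 * numReps n + 1 with hK
  have hr0 : (0 : ℝ) ≤ numReps n := Nat.cast_nonneg _
  have hK0 : 0 < K := by positivity
  have hsqrt : ∀ k : ℕ, √(k : ℝ) ≤ α * k + 1 / α := by
    intro k
    have h1 := Real.sq_sqrt (Nat.cast_nonneg k : (0 : ℝ) ≤ k)
    set y := √(k : ℝ)
    rw [← h1, ← sub_nonneg]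
    have : α * y ^ 2 + 1 / α - y = ((α * y - 1 / 2) ^ 2 + 3 / 4) / α := by field_simp; ring
    rw [this]
    positivity
  have hlin : ∀ k : ℕ, ENNReal.ofReal (K * √(k : ℝ)) ≤
      ENNReal.ofReal (K * α) * k + ENNReal.ofReal (K / α) := by
    intro k
    rw [← ENNReal.ofReal_natCast, ← ENNReal.ofReal_mul (by positivity),
      ← ENNReal.ofReal_add (by positivity) (by positivity)]
    refine ENNReal.ofReal_le_ofReal ?_
    have := mul_le_mul_of_nonneg_left (hsqrt k) hK0.le
    calc _ ≤ _ := this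
      _ = _ := by ring
  have hrelax : ∀ u, ENNReal.ofReal (258 * numReps n * √(D.degrees.inDeg u : ℝ)) ≤
      ENNReal.ofReal (K * α) * D.degrees.inDeg u + ENNReal.ofReal (K / α) := by
    intro u
    refine le_trans (ENNReal.ofReal_le_ofReal ?_) (hlin _)
    gcongr
    linarith
  refine (expectedQueries_longestPathAlgorithm_le_linear D (a := ENNReal.ofReal (K * α))
    (b := ENNReal.ofReal (K / α)) (fun k hk => ?_) s).trans ?_
  · refine le_trans ?_ (hlin k)
    rw [← ENNReal.ofReal_one, ← ENNReal.ofReal_add (by positivity) (by norm_num)]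
    refine ENNReal.ofReal_le_ofReal ?_
    have : 1 ≤ √(k : ℝ) := by rw [Real.one_le_sqrt]; exact_mod_cast hk
    rw [hK, add_mul]
    linarith
  · have hsum : ∀ d : Fin n → ℕ, ∑ u, d u = m →
        ∑ u, (ENNReal.ofReal (K * α) * d u + ENNReal.ofReal (K / α)) =
          ENNReal.ofReal (K * α) * m + n * ENNReal.ofReal (K / α) := by
      intro d hd
      rw [Finset.sum_add_distrib, ← Finset.mul_sum, ← Nat.cast_sum, hd]
      simp
    have hρ : ∑ u, ENNReal.ofReal (258 * numReps n * √(D.degrees.inDeg u : ℝ)) ≤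
        ENNReal.ofReal (K * α) * m + n * ENNReal.ofReal (K / α) :=
      (Finset.sum_le_sum fun u _ => hrelax u).trans_eq (hsum _ hin)
    have hw : (∑ u, if 0 < D.degrees.outDeg u then
        ENNReal.ofReal (K * α) * D.degrees.outDeg u + 2 * ENNReal.ofReal (K / α) +
          ENNReal.ofReal (258 * numReps n * √(D.degrees.inDeg u : ℝ)) else 0) ≤
        2 * (ENNReal.ofReal (K * α) * m) + 3 * (n * ENNReal.ofReal (K / α)) := by
      calc _ ≤ ∑ u, ((ENNReal.ofReal (K * α) * D.degrees.outDeg u + ENNReal.ofReal (K / α)) +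
            ENNReal.ofReal (K / α) +
            ENNReal.ofReal (258 * numReps n * √(D.degrees.inDeg u : ℝ))) := by
            refine Finset.sum_le_sum fun u _ => ?_
            split_ifs
            · rw [two_mul, ← add_assoc]
            · exact zero_le
        _ ≤ (ENNReal.ofReal (K * α) * m + n * ENNReal.ofReal (K / α)) +
            n * ENNReal.ofReal (K / α) +
            (ENNReal.ofReal (K * α) * m + n * ENNReal.ofReal (K / α)) := by
            rw [Finset.sum_add_distrib, Finset.sum_add_distrib, hsum _ hout]
            gcongr
            simp
        _ = _ := by ring
    refine (add_le_add hw hρ).trans ?_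
    have e1 : ENNReal.ofReal (K * α) * m = ENNReal.ofReal (K * √((n : ℝ) * m)) := by
      rw [← ENNReal.ofReal_natCast, ← ENNReal.ofReal_mul (by positivity), mul_assoc]
      congr 2
      rw [hα, Real.sqrt_div hn0.le, Real.sqrt_mul hn0.le, div_mul_eq_mul_div, mul_div_assoc,
        Real.div_sqrt]
    have e2 : n * ENNReal.ofReal (K / α) = ENNReal.ofReal (K * √((n : ℝ) * m)) := by
      rw [← ENNReal.ofReal_natCast, ← ENNReal.ofReal_mul (by positivity), mul_div_left_comm]
      congr 2
      rw [hα, Real.sqrt_div hn0.le, Real.sqrt_mul hn0.le, div_div_eq_mul_div, mul_comm (n : ℝ),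
        mul_div_assoc, Real.div_sqrt, mul_comm]
    rw [e1, e2]
    -- Seven shares of `K √(n m)`: five from the weights `w` and two from the weights `ρ`.
    have e3 : 2 * ENNReal.ofReal (K * √((n : ℝ) * m)) + 3 * ENNReal.ofReal (K * √((n : ℝ) * m)) +
        (ENNReal.ofReal (K * √((n : ℝ) * m)) + ENNReal.ofReal (K * √((n : ℝ) * m))) =
        ENNReal.ofReal (7 * (K * √((n : ℝ) * m))) := by
      rw [ENNReal.ofReal_mul (p := 7) (by norm_num), ENNReal.ofReal_ofNat]
      ring
    rw [e3]
    refine ENNReal.ofReal_le_ofReal ?_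
    have h1 := numReps_le_log hn2
    have h2 : 1 / 2 ≤ Real.log n := by
      have := Real.log_two_gt_d9
      have : Real.log 2 ≤ Real.log n := Real.log_le_log (by norm_num) (by exact_mod_cast hn2)
      linarith
    -- Here `7 * 2580 * 5 = 90300`, and the additive `7` is at most `14 log n`.
    have h3 : 7 * K ≤ 100000 * Real.log n := by rw [hK]; linarith
    calc _ = √((n : ℝ) * m) * (7 * K) := by ring
      _ ≤ √((n : ℝ) * m) * (100000 * Real.log n) := by gcongr
      _ = _ := by ring

end Main

theorem theorem4 :
    ∃ C : ℝ, 0 < C ∧ ∀ (n : ℕ) [NeZero n] (G : WeightedDAG n) (D : G.AdjLists) (s : Fin n),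
      (longestPathAlgorithm D.degrees s).expectedQueries D.oracle ≤
          ENNReal.ofReal (C * (√((n : ℝ) * (G.numEdges : ℝ)) * Real.log (n : ℝ))) ∧
        (longestPathAlgorithm D.degrees s).errorProb D.oracle (G.longestPathSolutions s) ≤
          ENNReal.ofReal (C / (n : ℝ)) := by
  refine ⟨100000, by norm_num, fun n _ G D s => ⟨expectedQueries_longestPathAlgorithm_le D s,
    (errorProb_longestPathAlgorithm_le D s).trans (ENNReal.ofReal_le_ofReal ?_)⟩⟩
  gcongr
  norm_num
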